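/- **Setting.** Let $f\in C([0,1])$ satisfy (F): $f(0)=f(1)=0$, $f>0$ on $(0,1)$, and for some $k>0$, $f(s)\le ks$ and $f(s)\le k(1-s)$ for all $s\in[0,1]$. Let $h\in C^2([0,1])$ satisfy (H): $h(0)=h'(0)=0$. Put $F(v)=\int_0^v f$ and $S(v)=\frac{F(v)-h(v)}{v}$ for $v\in(0,1]$, $S(0)=0$. For $\varepsilon>0$, a number $c\in\mathbb R$ is called admissible if the problem $$y'=(c+h'(v))\frac{\sqrt{y(2\varepsilon+y)}}{\varepsilon+y}-f(v)\ \text{ on }[0,1],\qquad y(0)=y(1)=0,\quad y>0\text{ on }(0,1),$$ has a solution. The critical speed $c_\varepsilon^*$ is the least admissible $c$, and the critical profile $v_\varepsilon$ is the unique $C^2$ function $v:\mathbb R\to\mathbb R$ with $0<v'<1$, $v(0)=\frac12$, $v(-\infty)=0$, $v(+\infty)=1$ and $$\varepsilon\Big(\frac{v'}{\sqrt{1-(v')^2}}\Big)'-(c_\varepsilon^*+h'(v))v'+f(v)=0 .$$ Let $\mathcal V_L(z;\underline z,\underline v)=\max\{0,\min\{1,z-\underline z+\underline v\}\}$. Given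 $\bar c$ with $\bar c+h'(\underline v)>0$, let $\mathcal V_I(\cdot;\underline z,\underline v)$ be the unique $C^1$ solution, with values in $[0,1]$, of $(\bar c+h'(v))v'=f(v)$, $v(\underline z)=\underline v$, on the interval under consideration. **Theorem.** For every $\varepsilon>0$, $c_\varepsilon^*$ and $v_\varepsilon$ are well defined. Write $\bar c=\lim_{\varepsilon\to0^+}c^*_\varepsilon$ and $\bar v=\lim_{\varepsilon\to0^+}v_\varepsilon$ (uniformly on $\mathbb R$). In each case below, the limits for which a value is given exist and have that value. 1. If $S'(v)<0$ for every $v\in(0,1]$, then $\bar c=0$; the set $\{\bar v>0\}$ is an interval containing $0$ on which $\bar v=\mathcal V_I(\cdot;0,\frac12)$, and $\bar v=0$ elsewhere. 2. If $0<\sup_{(0,1]}S\ne S(1)$, let $v_+$ be the largest solution $v\in(0,1]$ of $F(v)-h(v)=v(f(v)-h'(v))$ at which $S(v)=\sup_{(0,1]}S$; it exists, and $\bar c=f(v_+)-h'(v_+)$. If, moreover, $f-h'$ has exactly one local maximum point relative to $[0,1]$, then $v_+$ is the largest of all solutions in $(0,1]$ of that equation, $\bar v$ is $C^1$ on $\{\bar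 v>0\}$, and: - if $v_+\ge\frac12$, then $\bar v(z)=\mathcal V_L(z;0,\frac12)$ for $z\le v_+-\frac12$ and $\bar v(z)=\mathcal V_I(z;v_+-\frac12,v_+)$ for $z>v_+-\frac12$; - if $v_+<\frac12$, then $\bar v(z)=\mathcal V_L(z;z_+,v_+)$ for $z\le z_+$ and $\bar v(z)=\mathcal V_I(z;0,\frac12)$ for $z>z_+$, where $z_+<0$ is the unique real number with $\mathcal V_I(z_+;0,\frac12)=v_+$. 3. If $S'(v)>0$ for every $v\in(0,1)$, then $\bar c=F(1)-h(1)$ and $\bar v=\mathcal V_L(\cdot;0,\frac12)$ on $\mathbb R$. -/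

import Mathlib

open Set Filter Topology

noncomputable section

namespace BornInfeld

/-- The reaction assumption (F): `f` is continuous on `[0,1]`, vanishes at the end points, is
positive inside, and is bounded by `k s` and by `k (1 - s)` for some `k > 0`. -/
structure ReactionF (f : ℝ → ℝ) : Prop where
  continuousOn : ContinuousOn f (Icc 0 1)
  zero : f 0 = 0
  one : f 1 = 0
  pos : ∀ s ∈ Ioo (0 : ℝ) 1, 0 < f s
  bound : ∃ k > 0, ∀ s ∈ Icc (0 : ℝ) 1, f s ≤ k * s ∧ f s ≤ k * (1 - s)

/-- The derivative of a function on `[0,1]` (one-sided at the end points). -/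
def dI (g : ℝ → ℝ) (v : ℝ) : ℝ := derivWithin g (Icc 0 1) v

/-- The convection assumption (H): `h` is of class `C²` on `[0,1]` and `h(0) = h'(0) = 0`. -/
structure ConvectionH (h : ℝ → ℝ) : Prop where
  contDiffOn : ContDiffOn ℝ 2 h (Icc 0 1)
  zero : h 0 = 0
  deriv_zero : dI h 0 = 0

/-- The primitive `F(v) = ∫₀ᵛ f`. -/
def primitiveF (f : ℝ → ℝ) (v : ℝ) : ℝ := ∫ s in (0 : ℝ)..v, f s

/-- `S(v) = (F(v) - h(v)) / v`. Its value at `0` is `0`, which is also its limit there. -/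
def S (f h : ℝ → ℝ) (v : ℝ) : ℝ := (primitiveF f v - h v) / v

/-- `sup_{v ∈ (0,1]} S(v)`. -/
def supS (f h : ℝ → ℝ) : ℝ := sSup (S f h '' Ioc 0 1)

/-- `y` solves the first-order two-point problem
`y' = (c + h'(v)) √(y (2ε + y)) / (ε + y) - f(v)` on `[0,1]`, `y(0) = y(1) = 0`, `y > 0` on
`(0,1)`. -/
structure IsTwoPointSolution (f h : ℝ → ℝ) (ε c : ℝ) (y : ℝ → ℝ) : Prop where
  hasDeriv : ∀ v ∈ Icc (0 : ℝ) 1,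
    HasDerivWithinAt y
      ((c + dI h v) * (√(y v * (2 * ε + y v)) / (ε + y v)) - f v) (Icc 0 1) v
  zero : y 0 = 0
  one : y 1 = 0
  pos : ∀ v ∈ Ioo (0 : ℝ) 1, 0 < y v

/-- `c` is an admissible speed: the first-order two-point problem has a solution. -/
def IsAdmissible (f h : ℝ → ℝ) (ε c : ℝ) : Prop :=
  ∃ y : ℝ → ℝ, IsTwoPointSolution f h ε c y

/-- The critical speed `c*_ε`: the smallest admissible speed. -/
def criticalSpeed (f h : ℝ → ℝ) (ε : ℝ) : ℝ := sInf {c | IsAdmissible f h ε c}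

/-- `v` is the profile of a regular strictly increasing front with speed `c`, normalized by
`v(0) = 1/2`:
`ε (v' / √(1 - v'²))' - (c + h'(v)) v' + f(v) = 0`, `v(-∞) = 0`, `v(+∞) = 1`, `v' > 0`. -/
structure IsFrontProfile (f h : ℝ → ℝ) (ε c : ℝ) (v : ℝ → ℝ) : Prop where
  contDiff : ContDiff ℝ 2 v
  deriv_pos : ∀ z, 0 < deriv v z
  deriv_lt_one : ∀ z, deriv v z < 1
  equation : ∀ z,
    ε * deriv (fun x => deriv v x / √(1 - deriv v x ^ 2)) z
      - (c + dI h (v z)) * deriv v z + f (v z) = 0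
  tendsto_atBot : Tendsto v atBot (𝓝 0)
  tendsto_atTop : Tendsto v atTop (𝓝 1)
  normalized : v 0 = 1 / 2

/-- The critical profile `v_ε`: the normalized front profile with speed `c*_ε`. -/
def criticalProfile (f h : ℝ → ℝ) (ε : ℝ) : ℝ → ℝ :=
  Classical.epsilon fun v => IsFrontProfile f h ε (criticalSpeed f h ε) v

/-- The piecewise linear profile `𝒱_L(z; z₀, v₀)`: slope `1` through `(z₀, v₀)`, truncated
below at `0` and above at `1`. -/
def linearProfile (z₀ v₀ z : ℝ) : ℝ := max 0 (min 1 (z - z₀ + v₀))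

/-- `V` is, on the nondegenerate interval `J` containing `z₀`, a `C¹` solution with values in
`[0,1]` of the inviscid problem `(c + h'(V)) V' = f(V)`, `V(z₀) = v₀`, where `c + h'(v₀) > 0`. -/
structure IsInviscidSolution (f h : ℝ → ℝ) (c z₀ v₀ : ℝ) (J : Set ℝ) (V : ℝ → ℝ) : Prop where
  ordConnected : J.OrdConnected
  nontrivial : J.Nontrivial
  mem : z₀ ∈ J
  nondegenerate : 0 < c + dI h v₀
  initial : V z₀ = v₀
  mem_Icc : ∀ z ∈ J, V z ∈ Icc (0 : ℝ) 1
  contDiffOn : ContDiffOn ℝ 1 V J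
  equation : ∀ z ∈ J, (c + dI h (V z)) * derivWithin V J z = f (V z)

/-- `V` is on `J` the inviscid profile `𝒱_I(·; z₀, v₀)`: it is a solution on `J` of the inviscid
problem, and the only one, as every solution on any interval agrees with it on the common
domain. -/
def IsInviscidProfile (f h : ℝ → ℝ) (c z₀ v₀ : ℝ) (J : Set ℝ) (V : ℝ → ℝ) : Prop :=
  IsInviscidSolution f h c z₀ v₀ J V ∧
    ∀ (J' : Set ℝ) (W : ℝ → ℝ), IsInviscidSolution f h c z₀ v₀ J' W → EqOn W V (J ∩ J')

/-- The points of `(0,1]` solving `F(v) - h(v) = v (f(v) - h'(v))`. -/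
def tangencyPoints (f h : ℝ → ℝ) : Set ℝ :=
  {v | v ∈ Ioc (0 : ℝ) 1 ∧ primitiveF f v - h v = v * (f v - dI h v)}

/-- The function `g` has exactly one (relative) maximum point in `[0,1]`. -/
def HasUniqueMaximumPoint (g : ℝ → ℝ) : Prop :=
  ∃! m : ℝ, m ∈ Icc (0 : ℝ) 1 ∧ IsLocalMaxOn g (Icc 0 1) m

end BornInfeld

end

open BornInfeld

/-!
In terms of the height `v`, a front of slope `v'` is described by its flux
`w = ε v' / √(1 - v'²) = √(y (2ε + y))`, which satisfies `w' = c + h' - f Q(w)` and `w(1) = 0`, where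
`Q(w) = √(ε² + w²) / w = 1 / v' ≥ 1` decreases in `w`. As `Q` is decreasing, two fluxes can be
compared backward from `v = 1` (`le_of_deriv_le_of_lt`, `IsFlux.le_of_supersolution`). The flux is
therefore unique for every speed and depends on the speed in a monotone and Lipschitz way
(`IsFlux.le_add_of_le`), and it exists for every speed (`exists_isFlux`); the speed is admissible
when the flux vanishes at `v = 0`. Hence there is a least admissible speed. A front with flux `w`
passes the height `v` at the time `∫_{1/2}^v Q(w)`, so front profiles are the inverses of these
travel times (`IsFlux.isFrontProfile`, `IsFrontProfile.travelTime_eq`).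

Since `Q ≥ 1`, the flux lies below `P(v) = c v + h - F = v (c - S(v))`, so that `c ≥ S`. Conversely
`P(v) - d v / 2` is a supersolution when `c = sup S + d` and `ε k ≤ d² / 4`. Hence the critical speed
lies between `sup S` and `sup S + 2 √(ε k)`, suprema being over `[0,1]` with `S(0) = 0`
(`tendsto_criticalSpeed`).

For the profiles, the three cases of the theorem correspond to a height `vp` at which `S` attains its
maximum and above which `f - h' < S(vp)`: `vp = 0`, `vp` interior, and `vp = 1` (`IsTransition`).
The critical fluxes converge to `P` below `vp` and to `0` above it (`IsTransition.tendsto_flux`).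
By the flux equation `f Q(w) = c + h' - w'`, so the integrals of the nonnegative densities `f Q(w)`
over intervals converge, hence so do their integrals against the continuous function `1 / f`
(`tendsto_integral_mul_of_tendsto_integral`): these are the travel times. The limit travel time has
density `1` below `vp` and `(c + h') / f` above it, so its inverse is a line of slope `1` followed by
an inviscid profile; and as travel times expand distances, convergence of travel times gives uniform
convergence of the profiles (`IsTravelTime.tendstoUniformly_heightAt`).
-/

namespace BornInfeld

/-! ### Comparison and weak convergence -/

theorem hasDerivAt_sq_posPart (x : ℝ) : HasDerivAt (fun t : ℝ => max t 0 ^ 2) (2 * max x 0) x := by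
  rcases lt_trichotomy x 0 with hx | rfl | hx
  · have : (fun t : ℝ => max t 0 ^ 2) =ᶠ[𝓝 x] fun _ => 0 := by
      filter_upwards [gt_mem_nhds hx] with t ht
      simp [max_eq_right ht.le]
    rw [max_eq_right hx.le, mul_zero]
    exact (hasDerivAt_const x (0 : ℝ)).congr_of_eventuallyEq this
  · rw [hasDerivAt_iff_isLittleO]
    simp only [max_self, mul_zero, sub_zero, ne_eq, OfNat.ofNat_ne_zero, not_false_eq_true,
      zero_pow, smul_eq_mul]
    refine Asymptotics.IsBigO.trans_isLittleO (g := fun t : ℝ => t ^ 2) ?_ ?_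
    · refine Asymptotics.IsBigO.of_bound 1 (Eventually.of_forall fun t => ?_)
      rw [one_mul, norm_pow, norm_pow, Real.norm_eq_abs, Real.norm_eq_abs]
      refine pow_le_pow_left₀ (abs_nonneg _) ?_ 2
      rcases le_total t 0 with h | h
      · rw [max_eq_right h, abs_zero]; exact abs_nonneg t
      · rw [max_eq_left h]
    · exact Asymptotics.isLittleO_pow_id one_lt_two
  · have : (fun t : ℝ => max t 0 ^ 2) =ᶠ[𝓝 x] fun t => t ^ 2 := by
      filter_upwards [lt_mem_nhds hx] with t ht
      rw [max_eq_left ht.le]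
    rw [max_eq_left hx.le]
    simpa using (hasDerivAt_pow 2 x).congr_of_eventuallyEq this

/-- Backward comparison: if `w ≤ u` at the right end point and `w - u` grows wherever it is
positive, then `w ≤ u` throughout, since the square of the positive part of `w - u` is monotone. -/
theorem le_of_deriv_le_of_lt {a b : ℝ} {w u w' u' : ℝ → ℝ}
    (hw : ContinuousOn w (Icc a b)) (hu : ContinuousOn u (Icc a b))
    (hw' : ∀ x ∈ Ioo a b, HasDerivAt w (w' x) x) (hu' : ∀ x ∈ Ioo a b, HasDerivAt u (u' x) x)
    (hb : w b ≤ u b) (h : ∀ x ∈ Ioo a b, u x < w x → u' x ≤ w' x) :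
    ∀ x ∈ Icc a b, w x ≤ u x := by
  intro x hx
  have hd : ∀ x ∈ Ioo a b, HasDerivAt (fun t => max (w t - u t) 0 ^ 2)
      (2 * max (w x - u x) 0 * (w' x - u' x)) x := fun x hx =>
    HasDerivAt.comp (h₂ := fun t : ℝ => max t 0 ^ 2) (h := fun t => w t - u t) x
      (hasDerivAt_sq_posPart (w x - u x)) ((hw' x hx).sub (hu' x hx))
  have hmono : MonotoneOn (fun t => max (w t - u t) 0 ^ 2) (Icc a b) := by
    refine monotoneOn_of_deriv_nonneg (convex_Icc a b) (by fun_prop) ?_ ?_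
    · rw [interior_Icc]
      exact fun x hx => (hd x hx).differentiableAt.differentiableWithinAt
    · rw [interior_Icc]
      intro x hx
      rw [(hd x hx).deriv]
      rcases le_or_gt (w x) (u x) with hle | hlt
      · rw [max_eq_right (by linarith)]; simp
      · have := h x hx hlt
        exact mul_nonneg (by positivity) (by linarith)
  have hab : a ≤ b := hx.1.trans hx.2
  have hle := hmono hx (right_mem_Icc.2 hab) hx.2
  simp only [max_eq_right (sub_nonpos.2 hb)] at hle
  by_contra! hlt
  rw [max_eq_left (by linarith)] at hle
  nlinarith [sub_pos.2 hlt]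

/-- Weak convergence of nonnegative densities: if the distribution functions converge pointwise,
so do the integrals against a continuous function. For polynomials this is an integration by
parts, and polynomials are dense. -/
theorem tendsto_integral_mul_of_tendsto_integral {ι : Type*} {l : Filter ι}
    [l.IsCountablyGenerated] {a b : ℝ} (hab : a ≤ b) {ρ : ι → ℝ → ℝ} {ρ₀ ψ : ℝ → ℝ}
    (hρ : ∀ᶠ i in l, ContinuousOn (ρ i) (Icc a b) ∧ ∀ x ∈ Icc a b, 0 ≤ ρ i x)
    (hρ₀ : ContinuousOn ρ₀ (Icc a b)) (hρ₀' : ∀ x ∈ Icc a b, 0 ≤ ρ₀ x)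
    (hlim : ∀ x ∈ Icc a b, Tendsto (fun i => ∫ t in a..x, ρ i t) l (𝓝 (∫ t in a..x, ρ₀ t)))
    (hψ : ContinuousOn ψ (Icc a b)) :
    Tendsto (fun i => ∫ t in a..b, ψ t * ρ i t) l (𝓝 (∫ t in a..b, ψ t * ρ₀ t)) := by
  have hu : uIcc a b = Icc a b := uIcc_of_le hab
  have hsub : ∀ {x}, x ∈ Icc a b → uIcc a x ⊆ Icc a b := fun {x} hx => by
    rw [uIcc_of_le hx.1]; exact Icc_subset_Icc_right hx.2
  have hint : ∀ {r : ℝ → ℝ}, ContinuousOn r (Icc a b) → ∀ x ∈ Icc a b,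
      IntervalIntegrable r MeasureTheory.volume a x := fun hr x hx =>
    (hr.mono (hsub hx)).intervalIntegrable
  have hbI : b ∈ Icc a b := right_mem_Icc.2 hab
  have hprim : ∀ {r : ℝ → ℝ}, ContinuousOn r (Icc a b) →
      ContinuousOn (fun x => ∫ t in a..x, r t) (Icc a b) := fun {r} hr => by
    have hi : MeasureTheory.IntegrableOn r (uIcc a b) MeasureTheory.volume := by
      rw [hu]; exact hr.integrableOn_Icc
    have := intervalIntegral.continuousOn_primitive_interval hi
    rwa [hu] at this
  have hderiv : ∀ {r : ℝ → ℝ}, ContinuousOn r (Icc a b) → ∀ x ∈ Ioo a b,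
      HasDerivAt (fun x => ∫ t in a..x, r t) (r x) x := fun {r} hr x hx =>
    intervalIntegral.integral_hasDerivAt_right (hint hr x (Ioo_subset_Icc_self hx))
      ((hr.mono Ioo_subset_Icc_self).stronglyMeasurableAtFilter isOpen_Ioo x hx)
      (hr.continuousAt (Icc_mem_nhds hx.1 hx.2))
  have hparts : ∀ (p : Polynomial ℝ) {r : ℝ → ℝ}, ContinuousOn r (Icc a b) →
      ∫ t in a..b, p.eval t * r t
        = p.eval b * (∫ t in a..b, r t)
          - ∫ x in a..b, p.derivative.eval x * ∫ t in a..x, r t := by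
    intro p r hr
    have := intervalIntegral.integral_mul_deriv_eq_deriv_mul_of_hasDerivAt
      (a := a) (b := b) (u := fun x => p.eval x) (v := fun x => ∫ t in a..x, r t)
      (u' := fun x => p.derivative.eval x) (v' := r)
      p.continuous.continuousOn (by rw [hu]; exact hprim hr)
      (fun x _ => p.hasDerivAt x)
      (fun x hx => hderiv hr x (by simpa [hab] using hx))
      (p.derivative.continuous.intervalIntegrable _ _) (hint hr b hbI)
    simpa using this
  set M := ∫ t in a..b, ρ₀ t with hM
  have hM0 : 0 ≤ M := intervalIntegral.integral_nonneg hab hρ₀'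
  have hev : ∀ᶠ i in l, ∫ t in a..b, ρ i t ≤ M + 1 :=
    (hlim b hbI).eventually_le_const (lt_add_one M)
  have hpoly : ∀ p : Polynomial ℝ, Tendsto (fun i => ∫ t in a..b, p.eval t * ρ i t) l
      (𝓝 (∫ t in a..b, p.eval t * ρ₀ t)) := by
    intro p
    rw [hparts p hρ₀]
    have h1 : Tendsto (fun i => p.eval b * (∫ t in a..b, ρ i t)
        - ∫ x in a..b, p.derivative.eval x * ∫ t in a..x, ρ i t) l
        (𝓝 (p.eval b * (∫ t in a..b, ρ₀ t)
        - ∫ x in a..b, p.derivative.eval x * ∫ t in a..x, ρ₀ t)) := by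
      refine ((hlim b hbI).const_mul _).sub ?_
      refine intervalIntegral.tendsto_integral_filter_of_dominated_convergence
        (fun x => |p.derivative.eval x| * (M + 1)) ?_ ?_ ?_ ?_
      · filter_upwards [hρ] with i hi
        have : ContinuousOn (fun x => p.derivative.eval x * ∫ t in a..x, ρ i t) (Icc a b) :=
          p.derivative.continuous.continuousOn.mul (hprim hi.1)
        rw [uIoc_of_le hab]
        exact (this.mono Ioc_subset_Icc_self).aestronglyMeasurable measurableSet_Ioc
      · filter_upwards [hρ, hev] with i hi hi'
        refine Eventually.of_forall fun x hx => ?_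
        rw [uIoc_of_le hab] at hx
        have hx' := Ioc_subset_Icc_self hx
        rw [norm_mul, Real.norm_eq_abs, Real.norm_eq_abs]
        gcongr
        have h0 : 0 ≤ ∫ t in a..x, ρ i t := intervalIntegral.integral_nonneg hx'.1
          fun t ht => hi.2 t ⟨ht.1, ht.2.trans hx'.2⟩
        rw [abs_of_nonneg h0]
        refine le_trans ?_ hi'
        refine intervalIntegral.integral_mono_interval le_rfl hx'.1 hx'.2 ?_ (hint hi.1 b hbI)
        filter_upwards [MeasureTheory.ae_restrict_mem measurableSet_Ioc] with t ht
        exact hi.2 t (Ioc_subset_Icc_self ht)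
      · have : Continuous fun x => |p.derivative.eval x| * (M + 1) := by fun_prop
        exact this.intervalIntegrable _ _
      · refine Eventually.of_forall fun x hx => ?_
        rw [uIoc_of_le hab] at hx
        exact (hlim x (Ioc_subset_Icc_self hx)).const_mul _
    refine h1.congr' ?_
    filter_upwards [hρ] with i hi
    exact (hparts p hi.1).symm
  have happrox : ∀ (p : Polynomial ℝ) (η : ℝ), (∀ x ∈ Icc a b, |p.eval x - ψ x| < η) →
      ∀ r : ℝ → ℝ, ContinuousOn r (Icc a b) → (∀ x ∈ Icc a b, 0 ≤ r x) →
      |(∫ t in a..b, p.eval t * r t) - ∫ t in a..b, ψ t * r t| ≤ η * ∫ t in a..b, r t := by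
    intro p η hp r hr hr0
    rw [← intervalIntegral.integral_sub
      (hint (r := fun t => p.eval t * r t) (p.continuous.continuousOn.mul hr) b hbI)
      (hint (r := fun t => ψ t * r t) (hψ.mul hr) b hbI),
      ← intervalIntegral.integral_const_mul, ← Real.norm_eq_abs]
    refine intervalIntegral.norm_integral_le_of_norm_le hab ?_
      (hint (continuousOn_const.mul hr) b hbI)
    refine Eventually.of_forall fun t ht => ?_
    have ht' := Ioc_subset_Icc_self ht
    rw [← sub_mul, norm_mul, Real.norm_eq_abs, Real.norm_eq_abs, abs_of_nonneg (hr0 t ht')]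
    exact mul_le_mul_of_nonneg_right (hp t ht').le (hr0 t ht')
  rw [Metric.tendsto_nhds]
  intro e he
  obtain ⟨p, hp⟩ := exists_polynomial_near_of_continuousOn a b ψ hψ (e / (3 * (M + 1)))
    (by positivity)
  filter_upwards [hρ, hev, Metric.tendsto_nhds.1 (hpoly p) (e / 3) (by positivity)] with i hi hi' hd
  have h1 := happrox p _ hp (ρ i) hi.1 hi.2
  have h2 := happrox p _ hp ρ₀ hρ₀ hρ₀'
  have hc : e / (3 * (M + 1)) * (M + 1) = e / 3 := by field_simp
  have h1' : e / (3 * (M + 1)) * (∫ t in a..b, ρ i t) ≤ e / 3 := by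
    rw [← hc]; gcongr
  have h2' : e / (3 * (M + 1)) * M < e / 3 := by
    rw [← hc]; gcongr; linarith
  rw [Real.dist_eq] at hd ⊢
  rw [abs_le] at h1 h2
  rw [abs_lt] at hd ⊢
  constructor <;> linarith [h1.1, h1.2, h2.1, h2.2, hd.1, hd.2]

/-! ### Travel times and their inverses -/

/-- The time `∫_{1/2}^v τ` at which a front whose reciprocal slope at height `s` is `τ s` reaches
height `v`, time being counted from height `1/2`. -/
noncomputable def travelTime (τ : ℝ → ℝ) (v : ℝ) : ℝ := ∫ s in (1 / 2 : ℝ)..v, τ s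

theorem uIcc_half_subset {v : ℝ} (hv : v ∈ Ioo (0 : ℝ) 1) : uIcc (1 / 2) v ⊆ Ioo (0 : ℝ) 1 :=
  (convex_Ioo (0 : ℝ) 1).ordConnected.uIcc_subset (by norm_num) hv

theorem hasDerivAt_travelTime {τ : ℝ → ℝ} (hτ : ContinuousOn τ (Ioo 0 1)) {v : ℝ}
    (hv : v ∈ Ioo (0 : ℝ) 1) : HasDerivAt (travelTime τ) (τ v) v :=
  intervalIntegral.integral_hasDerivAt_right
    (hτ.mono (uIcc_half_subset hv)).intervalIntegrable
    (hτ.stronglyMeasurableAtFilter isOpen_Ioo v hv)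
    (hτ.continuousAt (Ioo_mem_nhds hv.1 hv.2))

/-- A travel time function on `(0,1)` whose speed is at most `1`: continuous, and expanding
distances. -/
structure IsTravelTime (T : ℝ → ℝ) : Prop where
  continuousOn : ContinuousOn T (Ioo 0 1)
  sub_le : ∀ a ∈ Ioo (0 : ℝ) 1, ∀ b ∈ Ioo (0 : ℝ) 1, a ≤ b → b - a ≤ T b - T a

theorem monotoneOn_of_hasDerivAt_nonneg {s : Set ℝ} (hs : Convex ℝ s) {g g' : ℝ → ℝ}
    (hc : ContinuousOn g s) (h : ∀ x ∈ interior s, HasDerivAt g (g' x) x)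
    (h0 : ∀ x ∈ interior s, 0 ≤ g' x) : MonotoneOn g s :=
  monotoneOn_of_deriv_nonneg hs hc
    (fun x hx => (h x hx).differentiableAt.differentiableWithinAt)
    fun x hx => by rw [(h x hx).deriv]; exact h0 x hx

theorem isTravelTime_travelTime {τ : ℝ → ℝ} (hτ : ContinuousOn τ (Ioo 0 1))
    (h1 : ∀ v ∈ Ioo (0 : ℝ) 1, 1 ≤ τ v) : IsTravelTime (travelTime τ) := by
  have hc : ContinuousOn (travelTime τ) (Ioo 0 1) := fun v hv =>
    (hasDerivAt_travelTime hτ hv).continuousAt.continuousWithinAt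
  refine ⟨hc, fun a ha b hb hab => ?_⟩
  have hm : MonotoneOn (fun v => travelTime τ v - v) (Ioo 0 1) := by
    refine monotoneOn_of_hasDerivAt_nonneg (g' := fun v => τ v - 1) (convex_Ioo 0 1)
      (hc.sub continuousOn_id) ?_ ?_ <;> rw [interior_Ioo]
    · exact fun v hv => (hasDerivAt_travelTime hτ hv).sub (hasDerivAt_id v)
    · exact fun v hv => sub_nonneg.2 (h1 v hv)
  have := hm ha hb hab
  simp only at this
  linarith

/-- The front with travel time `T`: the inverse of `T`, continued by `0` below the range of `T`
and by `1` above it. -/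
noncomputable def heightAt (T : ℝ → ℝ) (z : ℝ) : ℝ :=
  sSup ({0} ∪ {v | v ∈ Ioo (0 : ℝ) 1 ∧ T v ≤ z})

section heightAt

variable {T : ℝ → ℝ} {v z : ℝ}

theorem IsTravelTime.strictMonoOn (hT : IsTravelTime T) : StrictMonoOn T (Ioo 0 1) :=
  fun a ha b hb hab => by linarith [hT.sub_le a ha b hb hab.le]

theorem bddAbove_heightAt : BddAbove ({0} ∪ {v | v ∈ Ioo (0 : ℝ) 1 ∧ T v ≤ z}) :=
  ⟨1, by rintro v (rfl | ⟨hv, -⟩); exacts [zero_le_one, hv.2.le]⟩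

theorem heightAt_mem_Icc : heightAt T z ∈ Icc (0 : ℝ) 1 :=
  ⟨le_csSup bddAbove_heightAt (Or.inl rfl),
    csSup_le ⟨0, Or.inl rfl⟩ (by rintro v (rfl | ⟨hv, -⟩); exacts [zero_le_one, hv.2.le])⟩

theorem lt_of_heightAt_lt (hv : v ∈ Ioo (0 : ℝ) 1) (h : heightAt T z < v) : z < T v := by
  by_contra! hle
  exact h.not_ge (le_csSup bddAbove_heightAt (Or.inr ⟨hv, hle⟩))

theorem IsTravelTime.lt_of_lt_heightAt (hT : IsTravelTime T) (hv : v ∈ Ioo (0 : ℝ) 1)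
    (h : v < heightAt T z) : T v < z := by
  obtain ⟨u, hu | ⟨hu, huz⟩, hvu⟩ := exists_lt_of_lt_csSup
    (s := {0} ∪ {v | v ∈ Ioo (0 : ℝ) 1 ∧ T v ≤ z})
    ⟨0, Or.inl rfl⟩ h
  · rw [mem_singleton_iff] at hu
    subst hu
    exact absurd hvu hv.1.not_gt
  · exact (hT.strictMonoOn hv hu hvu).trans_le huz

theorem IsTravelTime.heightAt_eq (hT : IsTravelTime T) (hv : v ∈ Ioo (0 : ℝ) 1) (h : T v = z) :
    heightAt T z = v := by
  rcases lt_trichotomy (heightAt T z) v with hlt | heq | hgt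
  · exact absurd h (lt_of_heightAt_lt hv hlt).ne'
  · exact heq
  · exact absurd h (hT.lt_of_lt_heightAt hv hgt).ne

theorem IsTravelTime.apply_heightAt (hT : IsTravelTime T) (h : heightAt T z ∈ Ioo (0 : ℝ) 1) :
    T (heightAt T z) = z := by
  have hc := (hT.continuousOn.continuousAt (Ioo_mem_nhds h.1 h.2)).tendsto
  apply le_antisymm
  · refine le_of_tendsto (hc.mono_left (nhdsWithin_le_nhds (s := Iio (heightAt T z)))) ?_
    filter_upwards [self_mem_nhdsWithin, mem_nhdsWithin_of_mem_nhds (Ioo_mem_nhds h.1 h.2)]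
      with v hv hv' using (hT.lt_of_lt_heightAt hv' hv).le
  · refine ge_of_tendsto (hc.mono_left (nhdsWithin_le_nhds (s := Ioi (heightAt T z)))) ?_
    filter_upwards [self_mem_nhdsWithin, mem_nhdsWithin_of_mem_nhds (Ioo_mem_nhds h.1 h.2)]
      with v hv hv' using (lt_of_heightAt_lt hv' hv).le

theorem monotone_heightAt (T : ℝ → ℝ) : Monotone (heightAt T) := fun _ _ hz =>
  csSup_le_csSup bddAbove_heightAt ⟨0, Or.inl rfl⟩
    (union_subset_union_right _ fun _ hv => ⟨hv.1, hv.2.trans hz⟩)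

theorem IsTravelTime.heightAt_sub_le (hT : IsTravelTime T) {z₁ z₂ : ℝ} (hz : z₁ ≤ z₂) :
    heightAt T z₂ - heightAt T z₁ ≤ z₂ - z₁ := by
  by_contra! h
  have h0 := (heightAt_mem_Icc (T := T) (z := z₁)).1
  have h1 := (heightAt_mem_Icc (T := T) (z := z₂)).2
  set e := (heightAt T z₂ - heightAt T z₁ - (z₂ - z₁)) / 2 with he
  have he0 : 0 < e := by rw [he]; linarith
  have ha : heightAt T z₁ + e / 2 ∈ Ioo (0 : ℝ) 1 := ⟨by linarith, by linarith⟩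
  have hb : heightAt T z₂ - e / 2 ∈ Ioo (0 : ℝ) 1 := ⟨by linarith, by linarith⟩
  have h2 := lt_of_heightAt_lt (T := T) (z := z₁) ha (by linarith)
  have h3 := hT.lt_of_lt_heightAt (z := z₂) hb (by linarith)
  have h4 := hT.sub_le _ ha _ hb (by linarith)
  linarith

theorem IsTravelTime.continuous_heightAt (hT : IsTravelTime T) : Continuous (heightAt T) := by
  refine (LipschitzWith.of_le_add_mul 1 fun x y => ?_).continuous
  rw [NNReal.coe_one, one_mul, Real.dist_eq]
  rcases le_total x y with h | h
  · linarith [monotone_heightAt T h, abs_nonneg (x - y)]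
  · linarith [hT.heightAt_sub_le h, le_abs_self (x - y)]

theorem IsTravelTime.hasDerivAt_heightAt (hT : IsTravelTime T) (h : heightAt T z ∈ Ioo (0 : ℝ) 1)
    {t : ℝ} (ht : HasDerivAt T t (heightAt T z)) (ht0 : t ≠ 0) :
    HasDerivAt (heightAt T) t⁻¹ z := by
  refine HasDerivAt.of_local_left_inverse hT.continuous_heightAt.continuousAt ht ht0 ?_
  filter_upwards [hT.continuous_heightAt.continuousAt.preimage_mem_nhds (Ioo_mem_nhds h.1 h.2)]
    with y hy using hT.apply_heightAt hy

/-- Fronts converge uniformly as soon as their travel times converge pointwise: as the limit travel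
time is expanding, a finite grid of heights controls the fronts at all positions. -/
theorem IsTravelTime.tendstoUniformly_heightAt {ι : Type*} {l : Filter ι} (hT : IsTravelTime T)
    {Tn : ι → ℝ → ℝ} {V : ι → ℝ → ℝ}
    (hTn : ∀ᶠ i in l, StrictMonoOn (Tn i) (Ioo 0 1) ∧
      ∀ z, V i z ∈ Ioo (0 : ℝ) 1 ∧ Tn i (V i z) = z)
    (hlim : ∀ v ∈ Ioo (0 : ℝ) 1, Tendsto (fun i => Tn i v) l (𝓝 (T v))) :
    TendstoUniformly V (heightAt T) l := by
  rw [Metric.tendstoUniformly_iff]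
  intro e he
  obtain ⟨N, hN⟩ := exists_nat_gt (4 / e)
  have hN0 : (0 : ℝ) < N := lt_trans (by positivity) hN
  have hgrid : ∀ᶠ i in l, ∀ k ∈ Finset.range N, (k / N : ℝ) ∈ Ioo (0 : ℝ) 1 →
      |Tn i (k / N) - T (k / N)| < e / 4 := by
    rw [Filter.eventually_all_finset]
    intro k _
    by_cases hk : (k / N : ℝ) ∈ Ioo (0 : ℝ) 1
    · filter_upwards [Metric.tendsto_nhds.1 (hlim _ hk) (e / 4) (by positivity)] with i hi _
      rwa [Real.dist_eq] at hi
    · exact Eventually.of_forall fun i h => absurd h hk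
  -- a grid point in any interval longer than the mesh
  have hpick : ∀ a b : ℝ, 0 ≤ a → b ≤ 1 → a + e / 4 < b →
      ∃ k ∈ Finset.range N, a < (k / N : ℝ) ∧ (k / N : ℝ) < b := by
    intro a b ha hb hab
    have hNe : 1 < N * (e / 4) := by
      rw [div_lt_iff₀ he] at hN; linarith
    have h1 : a * N < (⌊a * N⌋₊ : ℝ) + 1 := Nat.lt_floor_add_one _
    have h2 : (⌊a * N⌋₊ : ℝ) ≤ a * N := Nat.floor_le (by positivity)
    have h3 : ((⌊a * N⌋₊ + 1 : ℕ) : ℝ) < b * N := by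
      push_cast; nlinarith
    refine ⟨⌊a * N⌋₊ + 1, ?_, ?_, ?_⟩
    · rw [Finset.mem_range]
      have : ((⌊a * N⌋₊ + 1 : ℕ) : ℝ) < N := by nlinarith
      exact_mod_cast this
    · rw [lt_div_iff₀ hN0]; push_cast; exact h1
    · rw [div_lt_iff₀ hN0]; exact h3
  filter_upwards [hTn, hgrid] with i ⟨hmono, hV⟩ hi z
  obtain ⟨hVz, hTV⟩ := hV z
  have hH := heightAt_mem_Icc (T := T) (z := z)
  rw [Real.dist_eq, abs_lt]
  constructor
  · by_contra! h
    obtain ⟨k, hk, h1, h2⟩ := hpick (heightAt T z + e / 2) (V i z) (by linarith [hH.1]) hVz.2.le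
      (by linarith)
    have hkI : (k / N : ℝ) ∈ Ioo (0 : ℝ) 1 := ⟨by linarith [hH.1], by linarith [hVz.2]⟩
    have h3 := hmono hkI hVz h2
    have hmI : (k / N : ℝ) - e / 2 ∈ Ioo (0 : ℝ) 1 := ⟨by linarith [hH.1], by linarith [hkI.2]⟩
    have h4 := lt_of_heightAt_lt (T := T) (z := z) hmI (by linarith)
    have h5 := hT.sub_le _ hmI _ hkI (by linarith)
    have h6 := abs_lt.1 (hi k hk hkI)
    linarith [h6.1]
  · by_contra! h
    obtain ⟨k, hk, h1, h2⟩ := hpick (V i z) (heightAt T z - e / 2) hVz.1.le (by linarith [hH.2])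
      (by linarith)
    have hkI : (k / N : ℝ) ∈ Ioo (0 : ℝ) 1 := ⟨by linarith [hVz.1], by linarith [hH.2]⟩
    have h3 := hmono hVz hkI h1
    have hmI : (k / N : ℝ) + e / 2 ∈ Ioo (0 : ℝ) 1 := ⟨by linarith [hkI.1], by linarith [hH.2]⟩
    have h4 := hT.lt_of_lt_heightAt (z := z) hmI (by linarith)
    have h5 := hT.sub_le _ hkI _ hmI (by linarith)
    have h6 := abs_lt.1 (hi k hk hkI)
    linarith [h6.2]

end heightAt

/-! ### The reaction and the convection -/

section data

variable {f h : ℝ → ℝ} {v c : ℝ}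

theorem ReactionF.nonneg (hf : ReactionF f) (hv : v ∈ Icc (0 : ℝ) 1) : 0 ≤ f v := by
  rcases hv.1.eq_or_lt with rfl | h0
  · exact hf.zero.ge
  rcases hv.2.eq_or_lt with rfl | h1
  · exact hf.one.ge
  exact (hf.pos v ⟨h0, h1⟩).le

theorem hasDerivWithinAt_integral_Icc {g : ℝ → ℝ} (hg : ContinuousOn g (Icc 0 1))
    (hv : v ∈ Icc (0 : ℝ) 1) :
    HasDerivWithinAt (fun u => ∫ x in (0 : ℝ)..u, g x) (g v) (Icc 0 1) v := by
  set G : ℝ → ℝ := IccExtend zero_le_one ((Icc (0 : ℝ) 1).domRestrict g) with hG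
  have hGc : Continuous G := hg.domRestrict.Icc_extend'
  have hGg : ∀ x ∈ Icc (0 : ℝ) 1, G x = g x := fun x hx => IccExtend_of_mem _ _ hx
  have h1 : HasDerivAt (fun u => ∫ x in (0 : ℝ)..u, G x) (G v) v :=
    intervalIntegral.integral_hasDerivAt_right (hGc.intervalIntegrable _ _)
      hGc.aestronglyMeasurable.stronglyMeasurableAtFilter hGc.continuousAt
  have h2 : ∀ x ∈ Icc (0 : ℝ) 1, ∫ t in (0 : ℝ)..x, g t = ∫ t in (0 : ℝ)..x, G t := by
    refine fun x hx => intervalIntegral.integral_congr fun t ht => (hGg t ?_).symm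
    rw [uIcc_of_le hx.1] at ht
    exact ⟨ht.1, ht.2.trans hx.2⟩
  rw [hGg v hv] at h1
  exact h1.hasDerivWithinAt.congr h2 (h2 v hv)

theorem ReactionF.hasDerivWithinAt_primitiveF (hf : ReactionF f) (hv : v ∈ Icc (0 : ℝ) 1) :
    HasDerivWithinAt (primitiveF f) (f v) (Icc 0 1) v :=
  hasDerivWithinAt_integral_Icc hf.continuousOn hv

theorem ConvectionH.hasDerivWithinAt (hh : ConvectionH h) (hv : v ∈ Icc (0 : ℝ) 1) :
    HasDerivWithinAt h (dI h v) (Icc 0 1) v :=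
  (hh.contDiffOn.differentiableOn (by norm_num) v hv).hasDerivWithinAt

theorem ConvectionH.continuousOn_dI (hh : ConvectionH h) : ContinuousOn (dI h) (Icc 0 1) :=
  hh.contDiffOn.continuousOn_derivWithin (uniqueDiffOn_Icc zero_lt_one) (by norm_num)

/-- The function `P(v) = c v + h(v) - F(v) = v (c - S(v))`, with derivative `c + h' - f`. It is the
flux of a front of slope `1` which starts at `0`. -/
noncomputable def unitSlopeFlux (f h : ℝ → ℝ) (c v : ℝ) : ℝ := c * v + h v - primitiveF f v

theorem hasDerivWithinAt_unitSlopeFlux (hf : ReactionF f) (hh : ConvectionH h)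
    (hv : v ∈ Icc (0 : ℝ) 1) :
    HasDerivWithinAt (unitSlopeFlux f h c) (c + dI h v - f v) (Icc 0 1) v := by
  have h1 : HasDerivWithinAt (fun v : ℝ => c * v) c (Icc 0 1) v := by
    simpa using ((hasDerivAt_id v).const_mul c).hasDerivWithinAt
  exact (h1.add (hh.hasDerivWithinAt hv)).sub (hf.hasDerivWithinAt_primitiveF hv)

theorem hasDerivAt_unitSlopeFlux (hf : ReactionF f) (hh : ConvectionH h)
    (hv : v ∈ Ioo (0 : ℝ) 1) :
    HasDerivAt (unitSlopeFlux f h c) (c + dI h v - f v) v :=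
  (hasDerivWithinAt_unitSlopeFlux hf hh (Ioo_subset_Icc_self hv)).hasDerivAt
    (Icc_mem_nhds hv.1 hv.2)

theorem continuousOn_unitSlopeFlux (hf : ReactionF f) (hh : ConvectionH h) :
    ContinuousOn (unitSlopeFlux f h c) (Icc 0 1) :=
  fun _ hv => (hasDerivWithinAt_unitSlopeFlux hf hh hv).continuousWithinAt

theorem unitSlopeFlux_zero (hh : ConvectionH h) : unitSlopeFlux f h c 0 = 0 := by
  simp [unitSlopeFlux, hh.zero, primitiveF]

theorem unitSlopeFlux_eq (hv : v ≠ 0) : unitSlopeFlux f h c v = v * (c - S f h v) := by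
  unfold unitSlopeFlux S
  field_simp
  ring

end data

/-! ### The flux equation -/

/-- The reciprocal `√(ε² + w²) / w` of the slope `p` of a front whose flux `ε p / √(1 - p²)`
equals `w`. -/
noncomputable def invSlope (ε w : ℝ) : ℝ := √(ε ^ 2 + w ^ 2) / w

section invSlope

variable {ε s t w δ : ℝ}

theorem one_le_invSlope (hw : 0 < w) : 1 ≤ invSlope ε w := by
  rw [invSlope, one_le_div hw]
  exact Real.le_sqrt_of_sq_le (by nlinarith [sq_nonneg ε])

theorem invSlope_pos (hw : 0 < w) : 0 < invSlope ε w := zero_lt_one.trans_le (one_le_invSlope hw)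

theorem invSlope_le (hε : 0 < ε) (hw : 0 < w) : invSlope ε w ≤ 1 + ε / w := by
  rw [invSlope, div_le_iff₀ hw, add_mul, div_mul_cancel₀ _ hw.ne']
  exact Real.sqrt_le_iff.2 ⟨by positivity, by nlinarith⟩

theorem div_le_invSlope (hw : 0 < w) : ε / w ≤ invSlope ε w := by
  rw [invSlope]
  gcongr
  exact Real.le_sqrt_of_sq_le (by nlinarith [sq_nonneg w])

theorem invSlope_anti (hs : 0 < s) (hst : s ≤ t) : invSlope ε t ≤ invSlope ε s := by
  have ht := hs.trans_le hst
  rw [invSlope, invSlope, div_le_div_iff₀ ht hs]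
  refine (pow_le_pow_iff_left₀ (by positivity) (by positivity) two_ne_zero).1 ?_
  rw [mul_pow, mul_pow, Real.sq_sqrt (by positivity), Real.sq_sqrt (by positivity)]
  have : s ^ 2 ≤ t ^ 2 := by gcongr
  nlinarith [sq_nonneg ε]

theorem invSlope_sub_le (hδ : 0 < δ) (hs : δ ≤ s) (hst : s ≤ t) :
    invSlope ε s - invSlope ε t ≤ invSlope ε δ / δ * (t - s) := by
  have hs0 := hδ.trans_le hs
  have ht0 := hs0.trans_le hst
  have h1 : invSlope ε s - invSlope ε t ≤ invSlope ε t / s * (t - s) := by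
    have h2 : invSlope ε s ≤ √(ε ^ 2 + t ^ 2) / s := by
      rw [invSlope]; gcongr
    have h3 : invSlope ε t / s * (t - s) = √(ε ^ 2 + t ^ 2) / s - invSlope ε t := by
      rw [invSlope]; field_simp
    linarith
  refine h1.trans ?_
  have h4 := invSlope_anti (ε := ε) hδ (hs.trans hst)
  have h5 := (invSlope_pos (ε := ε) hδ).le
  have : 0 ≤ t - s := sub_nonneg.2 hst
  gcongr

theorem continuousAt_invSlope (hw : 0 < w) : ContinuousAt (invSlope ε) w := by
  unfold invSlope
  exact ContinuousAt.div (by fun_prop) continuousAt_id hw.ne'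

end invSlope

/-- The flux `w = ε v' / √(1 - v'²)` of a front of speed `c`, as a function of the height `v` of
the front: a solution of `w' = c + h' - f √(ε² + w²) / w` on `(0,1)` which is positive there and
vanishes at `1`. The value at `0` is not prescribed. -/
structure IsFlux (f h : ℝ → ℝ) (ε c : ℝ) (w : ℝ → ℝ) : Prop where
  continuousOn : ContinuousOn w (Icc 0 1)
  pos : ∀ v ∈ Ioo (0 : ℝ) 1, 0 < w v
  one : w 1 = 0
  hasDeriv : ∀ v ∈ Ioo (0 : ℝ) 1, HasDerivAt w (c + dI h v - f v * invSlope ε (w v)) v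

section flux

variable {f h w w₁ w₂ : ℝ → ℝ} {ε c c₁ c₂ a b : ℝ}

theorem IsFlux.nonneg (hw : IsFlux f h ε c w) {v : ℝ} (hv : v ∈ Icc (0 : ℝ) 1) : 0 ≤ w v := by
  have : closure (Ioo (0 : ℝ) 1) = Icc 0 1 := closure_Ioo zero_ne_one
  have hc : ContinuousOn w (closure (Ioo 0 1)) := by rw [this]; exact hw.continuousOn
  exact le_on_closure (f := fun _ => (0 : ℝ)) (fun x hx => (hw.pos x hx).le) continuousOn_const hc
    (by rwa [this])

/-- A supersolution of the flux equation which is nonnegative at `1` lies above the flux. -/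
theorem IsFlux.le_of_supersolution (hf : ReactionF f) (hw : IsFlux f h ε c w) {u u' : ℝ → ℝ}
    (ha : 0 ≤ a) (hu : ContinuousOn u (Icc a 1)) (hu0 : ∀ v ∈ Ioo a 1, 0 < u v) (hu1 : 0 ≤ u 1)
    (hu' : ∀ v ∈ Ioo a 1, HasDerivAt u (u' v) v)
    (hle : ∀ v ∈ Ioo a 1, u' v ≤ c + dI h v - f v * invSlope ε (u v)) :
    ∀ v ∈ Icc a 1, w v ≤ u v := by
  have hsub : Ioo a 1 ⊆ Ioo 0 1 := Ioo_subset_Ioo_left ha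
  refine le_of_deriv_le_of_lt (hw.continuousOn.mono (Icc_subset_Icc_left ha)) hu
    (fun v hv => hw.hasDeriv v (hsub hv)) hu' (by rwa [hw.one]) fun v hv hlt => ?_
  refine (hle v hv).trans ?_
  have := invSlope_anti (ε := ε) (hu0 v hv) hlt.le
  have := mul_le_mul_of_nonneg_left this (hf.pos v (hsub hv)).le
  linarith

/-- The flux depends on the speed monotonically and in a Lipschitz way. -/
theorem IsFlux.le_add_of_le (hf : ReactionF f) (h₁ : IsFlux f h ε c₁ w₁) (h₂ : IsFlux f h ε c₂ w₂)
    (hc : c₁ ≤ c₂) {v : ℝ} (hv : v ∈ Icc (0 : ℝ) 1) : w₁ v ≤ w₂ v + (c₂ - c₁) * (1 - v) := by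
  have hnn : ∀ v ∈ Ioo (0 : ℝ) 1, 0 ≤ (c₂ - c₁) * (1 - v) := fun v hv =>
    mul_nonneg (sub_nonneg.2 hc) (sub_nonneg.2 hv.2.le)
  refine h₁.le_of_supersolution hf (u := fun v => w₂ v + (c₂ - c₁) * (1 - v))
    (u' := fun v => c₂ + dI h v - f v * invSlope ε (w₂ v) + (c₂ - c₁) * (-1)) le_rfl
    (h₂.continuousOn.add (by fun_prop)) (fun v hv => ?_) (by simp [h₂.one]) (fun v hv => ?_)
    (fun v hv => ?_) v hv
  · linarith [h₂.pos v hv, hnn v hv]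
  · exact (h₂.hasDeriv v hv).add (((hasDerivAt_id v).const_sub 1).const_mul _)
  · have := invSlope_anti (ε := ε) (h₂.pos v hv) (le_add_of_nonneg_right (hnn v hv))
    have := mul_le_mul_of_nonneg_left this (hf.pos v hv).le
    linarith

theorem IsFlux.eqOn (hf : ReactionF f) (h₁ : IsFlux f h ε c w₁) (h₂ : IsFlux f h ε c w₂) :
    EqOn w₁ w₂ (Icc 0 1) := fun v hv =>
  le_antisymm (by simpa using h₁.le_add_of_le hf h₂ le_rfl hv)
    (by simpa using h₂.le_add_of_le hf h₁ le_rfl hv)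

/-- As slopes are less than `1`, the flux grows less than the flux of a front of slope `1`. -/
theorem IsFlux.sub_unitSlopeFlux_anti (hf : ReactionF f) (hh : ConvectionH h)
    (hw : IsFlux f h ε c w) : AntitoneOn (fun v => w v - unitSlopeFlux f h c v) (Icc 0 1) := by
  have := monotoneOn_of_hasDerivAt_nonneg (convex_Icc (0 : ℝ) 1)
    (g := fun v => unitSlopeFlux f h c v - w v)
    (g' := fun v => c + dI h v - f v - (c + dI h v - f v * invSlope ε (w v)))
    ((continuousOn_unitSlopeFlux hf hh).sub hw.continuousOn)
    (by rw [interior_Icc]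
        exact fun v hv => (hasDerivAt_unitSlopeFlux hf hh hv).sub (hw.hasDeriv v hv))
    (by rw [interior_Icc]
        intro v hv
        nlinarith [hf.pos v hv, one_le_invSlope (ε := ε) (hw.pos v hv)])
  intro a ha b hb hab
  have := this ha hb hab
  simp only at this ⊢
  linarith

theorem IsFlux.le_unitSlopeFlux (hf : ReactionF f) (hh : ConvectionH h)
    (hw : IsFlux f h ε c w) (h0 : w 0 = 0) {v : ℝ} (hv : v ∈ Icc (0 : ℝ) 1) :
    w v ≤ unitSlopeFlux f h c v := by
  have := hw.sub_unitSlopeFlux_anti hf hh (left_mem_Icc.2 zero_le_one) hv hv.1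
  simp only [unitSlopeFlux_zero hh, h0] at this
  linarith

theorem slope_identity {y : ℝ} (hε : 0 < ε) (hy : 0 ≤ y) :
    √(ε ^ 2 + √(y * (2 * ε + y)) ^ 2) = ε + y := by
  rw [Real.sq_sqrt (by positivity), show ε ^ 2 + y * (2 * ε + y) = (ε + y) ^ 2 by ring,
    Real.sqrt_sq (by positivity)]

/-- Substituting `w = √(y (2ε + y))`, that is `ε + y = √(ε² + w²)`, turns the two-point problem
into the flux equation with the additional condition `w(0) = 0`. -/
theorem isFlux_of_hasDerivWithinAt {y : ℝ → ℝ} (hε : 0 < ε)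
    (hy : ∀ v ∈ Icc (0 : ℝ) 1, HasDerivWithinAt y
      ((c + dI h v) * (√(y v * (2 * ε + y v)) / (ε + y v)) - f v) (Icc 0 1) v)
    (hy1 : y 1 = 0) (hpos : ∀ v ∈ Ioo (0 : ℝ) 1, 0 < y v) :
    IsFlux f h ε c (fun v => √(y v * (2 * ε + y v))) where
  continuousOn := by
    have : ContinuousOn y (Icc 0 1) := fun v hv => (hy v hv).continuousWithinAt
    fun_prop
  pos v hv := by
    have := hpos v hv
    positivity
  one := by simp [hy1]
  hasDeriv v hv := by
    have hpos := hpos v hv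
    have hd := (hy v (Ioo_subset_Icc_self hv)).hasDerivAt (Icc_mem_nhds hv.1 hv.2)
    have hw : 0 < √(y v * (2 * ε + y v)) := by positivity
    have h1 := (hd.mul (hd.const_add (2 * ε))).sqrt (by simp only [Pi.mul_apply]; positivity)
    refine h1.congr_deriv ?_
    rw [invSlope, slope_identity hε hpos.le]
    simp only [Pi.mul_apply]
    set r := √(y v * (2 * ε + y v))
    field_simp
    ring

theorem slope_eq {x : ℝ} (hx : 0 ≤ x) :
    √((√(ε ^ 2 + x ^ 2) - ε) * (2 * ε + (√(ε ^ 2 + x ^ 2) - ε))) / (ε + (√(ε ^ 2 + x ^ 2) - ε))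
      = x / √(ε ^ 2 + x ^ 2) := by
  have hsq : √(ε ^ 2 + x ^ 2) ^ 2 = ε ^ 2 + x ^ 2 := Real.sq_sqrt (by positivity)
  have : (√(ε ^ 2 + x ^ 2) - ε) * (2 * ε + (√(ε ^ 2 + x ^ 2) - ε)) = x ^ 2 := by
    linarith
  rw [this, Real.sqrt_sq hx, add_sub_cancel]

theorem hasDerivWithinAt_sqrt_of_flux {s : Set ℝ} {v p q : ℝ}
    (hw : HasDerivWithinAt w (p - q * invSlope ε (w v)) s v) (hpos : 0 < w v) :
    HasDerivWithinAt (fun v => √(ε ^ 2 + w v ^ 2) - ε) (p * (w v / √(ε ^ 2 + w v ^ 2)) - q) s v := by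
  have h1 := (((hw.pow 2).const_add (ε ^ 2)).sqrt
      (by simp only [Pi.pow_apply]; positivity)).sub_const ε
  refine h1.congr_deriv ?_
  simp only [Pi.pow_apply, invSlope]
  have : 0 < √(ε ^ 2 + w v ^ 2) := by positivity
  set r := √(ε ^ 2 + w v ^ 2)
  field_simp
  push_cast
  ring

theorem IsFlux.isTwoPointSolution (hε : 0 < ε) (hf : ReactionF f) (hh : ConvectionH h)
    (hw : IsFlux f h ε c w) (h0 : w 0 = 0) :
    IsTwoPointSolution f h ε c (fun v => √(ε ^ 2 + w v ^ 2) - ε) := by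
  set y : ℝ → ℝ := fun v => √(ε ^ 2 + w v ^ 2) - ε with hydef
  have hpos' : ∀ v, 0 < √(ε ^ 2 + w v ^ 2) := fun v => by
    have : 0 < ε ^ 2 := by positivity
    positivity
  set y' : ℝ → ℝ := fun v => (c + dI h v) * (w v / √(ε ^ 2 + w v ^ 2)) - f v with hy'
  have hyc : ContinuousOn y (Icc 0 1) := by
    have := hw.continuousOn
    fun_prop
  have hy'c : ContinuousOn y' (Icc 0 1) := by
    have h1 := hw.continuousOn
    have h2 := hh.continuousOn_dI
    have h3 := hf.continuousOn
    refine ((continuousOn_const.add h2).mul (h1.div (by fun_prop) fun v _ => (hpos' v).ne')).sub h3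
  have hint : ∀ v ∈ Ioo (0 : ℝ) 1, HasDerivAt y (y' v) v := by
    intro v hv
    have hI := Icc_mem_nhds hv.1 hv.2
    exact (hasDerivWithinAt_sqrt_of_flux (hw.hasDeriv v hv).hasDerivWithinAt
      (hw.pos v hv)).hasDerivAt hI
  refine ⟨fun v hv => ?_, by simp [hydef, h0, Real.sqrt_sq hε.le],
    by simp [hydef, hw.one, Real.sqrt_sq hε.le], fun v hv => ?_⟩
  · rw [slope_eq (hw.nonneg hv)]
    change HasDerivWithinAt y (y' v) (Icc 0 1) v
    have hdiff : DifferentiableOn ℝ y (Ioo 0 1) := fun v hv =>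
      (hint v hv).differentiableAt.differentiableWithinAt
    rcases hv.1.eq_or_lt with rfl | h0'
    · have h1 : HasDerivWithinAt y (y' 0) (Ici 0) 0 := by
        refine hasDerivWithinAt_Ici_of_tendsto_deriv hdiff
          ((hyc 0 hv).mono Ioo_subset_Icc_self) (Ioo_mem_nhdsGT zero_lt_one) ?_
        have h2 : Tendsto y' (𝓝[Ioo 0 1] 0) (𝓝 (y' 0)) :=
          (hy'c 0 hv).mono_left (nhdsWithin_mono _ Ioo_subset_Icc_self)
        rw [nhdsWithin_Ioo_eq_nhdsGT zero_lt_one] at h2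
        refine h2.congr' ?_
        filter_upwards [Ioo_mem_nhdsGT (zero_lt_one' ℝ)] with x hx using (hint x hx).deriv.symm
      exact h1.mono Icc_subset_Ici_self
    rcases hv.2.eq_or_lt with rfl | h1'
    · have h1 : HasDerivWithinAt y (y' 1) (Iic 1) 1 := by
        refine hasDerivWithinAt_Iic_of_tendsto_deriv hdiff
          ((hyc 1 hv).mono Ioo_subset_Icc_self) (Ioo_mem_nhdsLT zero_lt_one) ?_
        have h2 : Tendsto y' (𝓝[Ioo 0 1] 1) (𝓝 (y' 1)) :=
          (hy'c 1 hv).mono_left (nhdsWithin_mono _ Ioo_subset_Icc_self)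
        rw [nhdsWithin_Ioo_eq_nhdsLT zero_lt_one] at h2
        refine h2.congr' ?_
        filter_upwards [Ioo_mem_nhdsLT (zero_lt_one' ℝ)] with x hx using (hint x hx).deriv.symm
      exact h1.mono Icc_subset_Iic_self
    exact (hint v ⟨h0', h1'⟩).hasDerivWithinAt
  · have hwp := hw.pos v hv
    simp only [hydef, sub_pos]
    exact Real.lt_sqrt_of_sq_lt (by nlinarith [sq_pos_of_pos hwp])

theorem isAdmissible_iff (hε : 0 < ε) (hf : ReactionF f) (hh : ConvectionH h) :
    IsAdmissible f h ε c ↔ ∃ w, IsFlux f h ε c w ∧ w 0 = 0 :=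
  ⟨fun ⟨_, hy⟩ => ⟨_, isFlux_of_hasDerivWithinAt hε hy.hasDeriv hy.one hy.pos, by simp [hy.zero]⟩,
    fun ⟨_, hw, h0⟩ => ⟨_, hw.isTwoPointSolution hε hf hh h0⟩⟩

end flux

/-! ### Existence of the flux -/

section existence

variable {f h A g : ℝ → ℝ} {ε c δ K : ℝ}

/-- The flux equation with the singularity at `0` cut off below the level `δ` has Lipschitz
coefficients. -/
theorem exists_cutoff_flux (hA : ContinuousOn A (Icc 0 1)) (hg : ContinuousOn g (Icc 0 1))
    (ε : ℝ) (hδ : 0 < δ) :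
    ∃ w : ℝ → ℝ, w 1 = δ ∧ ∀ v ∈ Icc (0 : ℝ) 1,
      HasDerivWithinAt w (A v - g v * invSlope ε (max (w v) δ)) (Icc 0 1) v := by
  obtain ⟨a, ha⟩ := isCompact_Icc.exists_bound_of_continuousOn hA
  obtain ⟨b, hb⟩ := isCompact_Icc.exists_bound_of_continuousOn hg
  have h0I : (0 : ℝ) ∈ Icc (0 : ℝ) 1 := left_mem_Icc.2 zero_le_one
  have ha0 : 0 ≤ a := (norm_nonneg _).trans (ha 0 h0I)
  have hb0 : 0 ≤ b := (norm_nonneg _).trans (hb 0 h0I)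
  set q := invSlope ε δ with hq
  have hq0 : 0 < q := invSlope_pos hδ
  have hlip : ∀ x y : ℝ, |invSlope ε (max x δ) - invSlope ε (max y δ)| ≤ q / δ * |x - y| := by
    have key : ∀ x y : ℝ, x ≤ y →
        |invSlope ε (max x δ) - invSlope ε (max y δ)| ≤ q / δ * |x - y| := by
      intro x y hxy
      have hm : max x δ ≤ max y δ := max_le_max_right δ hxy
      have h1 := invSlope_sub_le (ε := ε) hδ (le_max_right x δ) hm
      have h2 := invSlope_anti (ε := ε) (hδ.trans_le (le_max_right x δ)) hm
      rw [abs_of_nonneg (sub_nonneg.2 h2)]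
      refine h1.trans ?_
      have h3 : max y δ - max x δ ≤ |x - y| := by
        have := abs_max_sub_max_le_abs y x δ
        rw [abs_sub_comm x y]
        exact (le_abs_self _).trans this
      gcongr
    intro x y
    rcases le_total x y with hxy | hxy
    · exact key x y hxy
    · rw [abs_sub_comm, abs_sub_comm x y]; exact key y x hxy
  have hPL : IsPicardLindelof (fun v x => A v - g v * invSlope ε (max x δ))
      (⟨1, right_mem_Icc.2 zero_le_one⟩ : Icc (0 : ℝ) 1) δ (a + b * q).toNNReal 0
      (a + b * q).toNNReal (b * (q / δ)).toNNReal := by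
    refine ⟨fun v hv => LipschitzOnWith.of_dist_le_mul fun x _ y _ => ?_,
      fun x _ => hA.sub (hg.mul continuousOn_const), fun v hv x _ => ?_, ?_⟩
    · rw [Real.coe_toNNReal _ (by positivity), Real.dist_eq, Real.dist_eq,
        sub_sub_sub_cancel_left, ← mul_sub, abs_mul, mul_assoc, abs_sub_comm (invSlope ε _)]
      exact mul_le_mul (hb v hv) (hlip x y) (abs_nonneg _) hb0
    · rw [Real.coe_toNNReal _ (by positivity)]
      refine (norm_sub_le _ _).trans (add_le_add (ha v hv) ?_)
      rw [norm_mul]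
      have hm : 0 < max x δ := hδ.trans_le (le_max_right x δ)
      refine mul_le_mul (hb v hv) ?_ (norm_nonneg _) hb0
      rw [Real.norm_eq_abs, abs_of_pos (invSlope_pos hm)]
      exact invSlope_anti hδ (le_max_right x δ)
    · simp
  exact hPL.exists_eq_forall_mem_Icc_hasDerivWithinAt₀

/-- With the additional reaction `η = K / invSlope ε δ`, where `K` bounds the coefficient `A`, the
constant `δ` is a barrier from below, so that the cut-off is not active. -/
theorem exists_regularized_flux (hA : ContinuousOn A (Icc 0 1)) (hg : ContinuousOn g (Icc 0 1))
    (hg0 : ∀ v ∈ Icc (0 : ℝ) 1, 0 ≤ g v) (hK : ∀ v ∈ Icc (0 : ℝ) 1, |A v| ≤ K) (ε : ℝ)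
    (hδ : 0 < δ) :
    ∃ w : ℝ → ℝ, w 1 = δ ∧ (∀ v ∈ Icc (0 : ℝ) 1, δ ≤ w v) ∧ ∀ v ∈ Icc (0 : ℝ) 1,
      HasDerivWithinAt w (A v - (g v + K / invSlope ε δ) * invSlope ε (w v)) (Icc 0 1) v := by
  have hK0 : 0 ≤ K := (abs_nonneg _).trans (hK 0 (left_mem_Icc.2 zero_le_one))
  have hq := invSlope_pos (ε := ε) hδ
  obtain ⟨w, hw1, hw⟩ := exists_cutoff_flux (g := fun v => g v + K / invSlope ε δ) hA
    (hg.add continuousOn_const) ε hδ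
  have hle : ∀ v ∈ Icc (0 : ℝ) 1, δ ≤ w v := by
    refine le_of_deriv_le_of_lt (w := fun _ => δ) (w' := fun _ => 0) continuousOn_const
      (fun v hv => (hw v hv).continuousWithinAt) (fun v _ => hasDerivAt_const v δ)
      (fun v hv => (hw v (Ioo_subset_Icc_self hv)).hasDerivAt (Icc_mem_nhds hv.1 hv.2)) hw1.ge ?_
    intro v hv hlt
    have hv' := Ioo_subset_Icc_self hv
    rw [max_eq_right hlt.le, add_mul, div_mul_cancel₀ _ hq.ne']
    have := mul_nonneg (hg0 v hv') hq.le
    linarith [(abs_le.1 (hK v hv')).2]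
  refine ⟨w, hw1, hle, fun v hv => ?_⟩
  have := hw v hv
  rwa [max_eq_left (hle v hv)] at this

/-- For every speed there is a flux: the regularized fluxes decrease with `δ`, and the functions
`√(ε² + w²) - ε` are equi-Lipschitz up to the end points, so that the limit `δ → 0` can be taken in
the integrated equation. The limit does not vanish inside, since at an interior minimum the
derivative would be `-f < 0`. -/
theorem exists_isFlux (hf : ReactionF f) (hh : ConvectionH h) (hε : 0 < ε) (c : ℝ) :
    ∃ w, IsFlux f h ε c w := by
  have hA : ContinuousOn (fun v => c + dI h v) (Icc 0 1) := continuousOn_const.add hh.continuousOn_dI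
  obtain ⟨K, hK⟩ := isCompact_Icc.exists_bound_of_continuousOn hA
  obtain ⟨b, hb⟩ := isCompact_Icc.exists_bound_of_continuousOn hf.continuousOn
  have h0I : (0 : ℝ) ∈ Icc (0 : ℝ) 1 := left_mem_Icc.2 zero_le_one
  have h1I : (1 : ℝ) ∈ Icc (0 : ℝ) 1 := right_mem_Icc.2 zero_le_one
  have hK0 : 0 ≤ K := (norm_nonneg _).trans (hK 0 h0I)
  have hb0 : 0 ≤ b := (norm_nonneg _).trans (hb 0 h0I)
  set δ : ℕ → ℝ := fun n => 1 / ((n : ℝ) + 1) with hδdef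
  have hδ : ∀ n, 0 < δ n := fun n => Nat.one_div_pos_of_nat
  have hδanti : Antitone δ := fun m n hmn => Nat.one_div_le_one_div hmn
  have hδlim : Tendsto δ atTop (𝓝 0) := tendsto_one_div_add_atTop_nhds_zero_nat
  choose w hw1 hwδ hw using fun n =>
    exists_regularized_flux hA hf.continuousOn (fun v hv => hf.nonneg hv) hK ε (hδ n)
  set η : ℕ → ℝ := fun n => K / invSlope ε (δ n) with hη
  have hη0 : ∀ n, 0 ≤ η n := fun n => div_nonneg hK0 (invSlope_pos (hδ n)).le
  have hηK : ∀ n, η n ≤ K := fun n => div_le_self hK0 (one_le_invSlope (hδ n))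
  have hηlim : Tendsto η atTop (𝓝 0) := by
    have : Tendsto (fun n => K * (δ n / ε)) atTop (𝓝 0) := by
      simpa using (hδlim.div_const ε).const_mul K
    refine squeeze_zero hη0 (fun n => ?_) this
    have h1 := div_le_invSlope (ε := ε) (hδ n)
    have h2 : 0 < ε / δ n := div_pos hε (hδ n)
    calc η n ≤ K / (ε / δ n) := by simp only [hη]; gcongr
      _ = K * (δ n / ε) := by rw [div_eq_mul_inv K, inv_div]
  have hwpos : ∀ n, ∀ v ∈ Icc (0 : ℝ) 1, 0 < w n v := fun n v hv => (hδ n).trans_le (hwδ n v hv)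
  have hanti : ∀ v ∈ Icc (0 : ℝ) 1, Antitone fun n => w n v := by
    intro v hv m n hmn
    refine le_of_deriv_le_of_lt (fun v hv => (hw n v hv).continuousWithinAt)
      (fun v hv => (hw m v hv).continuousWithinAt)
      (fun v hv => (hw n v (Ioo_subset_Icc_self hv)).hasDerivAt (Icc_mem_nhds hv.1 hv.2))
      (fun v hv => (hw m v (Ioo_subset_Icc_self hv)).hasDerivAt (Icc_mem_nhds hv.1 hv.2))
      (by rw [hw1, hw1]; exact hδanti hmn) (fun v hv hlt => ?_) v hv
    have hv' := Ioo_subset_Icc_self hv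
    have h1 := invSlope_anti (ε := ε) (hwpos m v hv') hlt.le
    have h2 : K / invSlope ε (δ n) ≤ K / invSlope ε (δ m) := by
      have := invSlope_pos (ε := ε) (hδ m)
      have := invSlope_anti (ε := ε) (hδ n) (hδanti hmn)
      gcongr
    have h3 : 0 ≤ f v + K / invSlope ε (δ n) := add_nonneg (hf.nonneg hv') (hη0 n)
    have h4 := mul_le_mul (add_le_add_right h2 (f v)) h1 (invSlope_pos (hwpos n v hv')).le
      (h3.trans (add_le_add_right h2 (f v)))
    linarith
  set W : ℝ → ℝ := fun v => ⨅ n, w n v with hW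
  have hWlim : ∀ v ∈ Icc (0 : ℝ) 1, Tendsto (fun n => w n v) atTop (𝓝 (W v)) := fun v hv =>
    tendsto_atTop_ciInf (hanti v hv) ⟨0, by rintro _ ⟨n, rfl⟩; exact (hwpos n v hv).le⟩
  have hW0 : ∀ v ∈ Icc (0 : ℝ) 1, 0 ≤ W v := fun v hv =>
    ge_of_tendsto' (hWlim v hv) fun n => (hwpos n v hv).le
  have hW1 : W 1 = 0 := by
    refine tendsto_nhds_unique (hWlim 1 h1I) ?_
    simpa only [hw1] using hδlim
  set E : ℝ → ℝ := fun x => √(ε ^ 2 + x ^ 2) - ε with hE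
  have hEc : Continuous E := by fun_prop
  have hrpos : ∀ x : ℝ, 0 < √(ε ^ 2 + x ^ 2) := fun x => by positivity
  set ψ : ℝ → ℝ := fun x => x / √(ε ^ 2 + x ^ 2) with hψ
  have hψc : Continuous ψ := by
    refine continuous_id.div (by fun_prop) fun x => (hrpos x).ne'
  have hψ1 : ∀ x, |ψ x| ≤ 1 := fun x => by
    simp only [hψ]
    rw [abs_div, abs_of_pos (hrpos x), div_le_one (hrpos x)]
    exact Real.abs_le_sqrt (by nlinarith)
  have hEd : ∀ n, ∀ v ∈ Icc (0 : ℝ) 1, HasDerivWithinAt (fun v => E (w n v))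
      ((c + dI h v) * ψ (w n v) - (f v + η n)) (Icc 0 1) v := fun n v hv =>
    hasDerivWithinAt_sqrt_of_flux (hw n v hv) (hwpos n v hv)
  have hElim : ∀ v ∈ Icc (0 : ℝ) 1, Tendsto (fun n => E (w n v)) atTop (𝓝 (E (W v))) :=
    fun v hv => (hEc.tendsto _).comp (hWlim v hv)
  have hbound : ∀ n, ∀ v ∈ Icc (0 : ℝ) 1,
      ‖(c + dI h v) * ψ (w n v) - (f v + η n)‖ ≤ K + (b + K) := by
    intro n v hv
    refine (norm_sub_le _ _).trans (add_le_add ?_ ((norm_add_le _ _).trans (add_le_add (hb v hv) ?_)))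
    · rw [norm_mul]
      calc _ ≤ K * 1 := mul_le_mul (hK v hv) (hψ1 _) (abs_nonneg _) hK0
        _ = K := mul_one K
    · rw [Real.norm_of_nonneg (hη0 n)]; exact hηK n
  have hElip : ∀ u ∈ Icc (0 : ℝ) 1, ∀ v ∈ Icc (0 : ℝ) 1,
      ‖E (W v) - E (W u)‖ ≤ (K + (b + K)) * ‖v - u‖ := fun u hu v hv =>
    le_of_tendsto ((hElim v hv).sub (hElim u hu)).norm (Eventually.of_forall fun n =>
      (convex_Icc (0 : ℝ) 1).norm_image_sub_le_of_norm_hasDerivWithin_le (hEd n) (hbound n) hu hv)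
  have hEWc : ContinuousOn (fun v => E (W v)) (Icc 0 1) := by
    refine (LipschitzOnWith.of_dist_le_mul (K := (K + (b + K)).toNNReal)
      fun u hu v hv => ?_).continuousOn
    rw [Real.coe_toNNReal _ (by positivity), dist_eq_norm, dist_eq_norm]
    exact hElip v hv u hu
  have hWE : ∀ v ∈ Icc (0 : ℝ) 1, √(E (W v) * (2 * ε + E (W v))) / (ε + E (W v)) = ψ (W v) :=
    fun v hv => slope_eq (hW0 v hv)
  have hE0 : ∀ x, 0 ≤ E x := fun x => by
    simp only [hE, sub_nonneg]
    exact Real.le_sqrt_of_sq_le (by nlinarith)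
  set G : ℝ → ℝ := fun v => (c + dI h v) * (√(E (W v) * (2 * ε + E (W v))) / (ε + E (W v))) - f v
    with hG
  have hGc : ContinuousOn G (Icc 0 1) := by
    have h1 := hf.continuousOn
    refine (hA.mul ((hEWc.mul (continuousOn_const.add hEWc)).sqrt.div
      (continuousOn_const.add hEWc) fun v _ => ?_)).sub h1
    exact (add_pos_of_pos_of_nonneg hε (hE0 _)).ne'
  have hint : ∀ v ∈ Icc (0 : ℝ) 1, E (W v) = E (W 0) + ∫ t in (0 : ℝ)..v, G t := by
    intro v hv
    have hsub : uIcc 0 v ⊆ Icc (0 : ℝ) 1 := by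
      rw [uIcc_of_le hv.1]; exact Icc_subset_Icc_right hv.2
    have hcn : ∀ n, ContinuousOn (fun v => (c + dI h v) * ψ (w n v) - (f v + η n)) (Icc 0 1) :=
      fun n => (hA.mul (hψc.comp_continuousOn fun v hv => (hw n v hv).continuousWithinAt)).sub
        (hf.continuousOn.add continuousOn_const)
    have h1 : ∀ n, ∫ t in (0 : ℝ)..v, ((c + dI h t) * ψ (w n t) - (f t + η n))
        = E (w n v) - E (w n 0) := fun n =>
      intervalIntegral.integral_eq_sub_of_hasDerivAt_of_le hv.1
        (fun t ht => ((hEd n t ⟨ht.1, ht.2.trans hv.2⟩).continuousWithinAt).mono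
          (Icc_subset_Icc_right hv.2))
        (fun t ht => (hEd n t ⟨ht.1.le, ht.2.le.trans hv.2⟩).hasDerivAt
          (Icc_mem_nhds ht.1 (ht.2.trans_le hv.2)))
        ((hcn n).mono hsub).intervalIntegrable
    have h2 : Tendsto (fun n => ∫ t in (0 : ℝ)..v, ((c + dI h t) * ψ (w n t) - (f t + η n))) atTop
        (𝓝 (∫ t in (0 : ℝ)..v, G t)) := by
      refine intervalIntegral.tendsto_integral_filter_of_dominated_convergence
        (fun _ => K + (b + K)) (Eventually.of_forall fun n => ?_)
        (Eventually.of_forall fun n => Eventually.of_forall fun t ht => ?_)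
        intervalIntegrable_const (Eventually.of_forall fun t ht => ?_)
      · exact ((hcn n).mono (uIoc_subset_uIcc.trans hsub)).aestronglyMeasurable measurableSet_uIoc
      · exact hbound n t (hsub (uIoc_subset_uIcc ht))
      · have ht' := hsub (uIoc_subset_uIcc ht)
        simp only [hG]
        rw [hWE t ht']
        have := (((hψc.tendsto _).comp (hWlim t ht')).const_mul (c + dI h t)).sub
          (hηlim.const_add (f t))
        simpa using this
    simp only [h1] at h2
    have h3 := tendsto_nhds_unique h2 ((hElim v hv).sub (hElim 0 h0I))
    linarith
  have hd : ∀ v ∈ Icc (0 : ℝ) 1, HasDerivWithinAt (fun v => E (W v)) (G v) (Icc 0 1) v :=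
    fun v hv => ((hasDerivWithinAt_integral_Icc hGc hv).const_add (E (W 0))).congr hint (hint v hv)
  refine ⟨_, isFlux_of_hasDerivWithinAt hε hd (by simp [hE, hW1, Real.sqrt_sq hε.le]) ?_⟩
  intro v hv
  have hv' := Ioo_subset_Icc_self hv
  refine (hE0 (W v)).lt_of_ne' fun hzero => ?_
  have hnhds := Icc_mem_nhds hv.1 hv.2
  have hmin : IsLocalMin (fun v => E (W v)) v := by
    filter_upwards with u
    rw [hzero]; exact hE0 _
  have := hmin.hasDerivAt_eq_zero ((hd v hv').hasDerivAt hnhds)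
  simp only [hG, hzero] at this
  simp at this
  exact (hf.pos v hv).ne' this

end existence

/-! ### The critical speed -/

section speed

variable {f h w : ℝ → ℝ} {ε c cb v : ℝ}

theorem S_zero : S f h 0 = 0 := by simp [S]

theorem hasDerivWithinAt_S (hf : ReactionF f) (hh : ConvectionH h) (hv : v ∈ Ioc (0 : ℝ) 1) :
    HasDerivWithinAt (S f h) ((f v - dI h v - S f h v) / v) (Icc 0 1) v := by
  have hv' := Ioc_subset_Icc_self hv
  have hv0 := hv.1.ne'
  refine (((hf.hasDerivWithinAt_primitiveF hv').sub (hh.hasDerivWithinAt hv')).div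
    (hasDerivWithinAt_id v _) hv0).congr_deriv ?_
  simp only [S, Pi.sub_apply, id]
  field_simp

theorem dI_S (hf : ReactionF f) (hh : ConvectionH h) (hv : v ∈ Ioc (0 : ℝ) 1) :
    dI (S f h) v = (f v - dI h v - S f h v) / v :=
  (hasDerivWithinAt_S hf hh hv).derivWithin (uniqueDiffOn_Icc zero_lt_one v (Ioc_subset_Icc_self hv))

/-- The value `0` of `S` at `0` is its limit there, the derivative of `F - h` at `0`. -/
theorem continuousOn_S (hf : ReactionF f) (hh : ConvectionH h) : ContinuousOn (S f h) (Icc 0 1) := by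
  intro v hv
  rcases hv.1.eq_or_lt with rfl | h0
  · have h1 := (hf.hasDerivWithinAt_primitiveF hv).sub (hh.hasDerivWithinAt hv)
    rw [hf.zero, hh.deriv_zero, sub_zero, hasDerivWithinAt_iff_tendsto_slope] at h1
    rw [← continuousWithinAt_sdiff_self, ContinuousWithinAt, S_zero]
    refine h1.congr' ?_
    filter_upwards with v
    simp [slope_def_field, S, hh.zero, primitiveF]
  · exact (hasDerivWithinAt_S hf hh ⟨h0, hv.2⟩).continuousWithinAt

/-- Slopes less than `1` force the speed to be at least `S`. -/
theorem IsAdmissible.S_le (hf : ReactionF f) (hh : ConvectionH h) (hε : 0 < ε)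
    (hc : IsAdmissible f h ε c) (hv : v ∈ Icc (0 : ℝ) 1) : S f h v ≤ c := by
  obtain ⟨w, hw, hw0⟩ := (isAdmissible_iff hε hf hh).1 hc
  have hcl : closure (Ioo (0 : ℝ) 1) = Icc 0 1 := closure_Ioo zero_ne_one
  refine le_on_closure (g := fun _ => c) (s := Ioo (0 : ℝ) 1) (fun v hv => ?_)
    (by rw [hcl]; exact continuousOn_S hf hh) continuousOn_const (by rwa [hcl])
  have h1 := (hw.pos v hv).trans_le (hw.le_unitSlopeFlux hf hh hw0 (Ioo_subset_Icc_self hv))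
  rw [unitSlopeFlux_eq hv.1.ne'] at h1
  exact (sub_pos.1 (pos_of_mul_pos_right h1 hv.1.le)).le

/-- Above the supremum of `S`, the function `P(v) - d v / 2`, with `P` the flux of a front of
slope `1`, is a supersolution of the flux equation vanishing at `0`. -/
theorem isAdmissible_add (hf : ReactionF f) (hh : ConvectionH h) (hε : 0 < ε) {k d : ℝ}
    (hk : ∀ s ∈ Icc (0 : ℝ) 1, f s ≤ k * s)
    (hcb : ∀ v ∈ Ioc (0 : ℝ) 1, S f h v ≤ cb) (hd : 0 < d) (hkd : ε * k ≤ d ^ 2 / 4) :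
    IsAdmissible f h ε (cb + d) := by
  obtain ⟨w, hw⟩ := exists_isFlux hf hh hε (cb + d)
  refine (isAdmissible_iff hε hf hh).2 ⟨w, hw, ?_⟩
  have hu : ∀ v ∈ Ioc (0 : ℝ) 1, d / 2 * v ≤ unitSlopeFlux f h (cb + d) v - d / 2 * v := by
    intro v hv
    rw [unitSlopeFlux_eq hv.1.ne']
    nlinarith [hcb v hv, hv.1]
  have hle := hw.le_of_supersolution hf
    (u := fun v => unitSlopeFlux f h (cb + d) v - d / 2 * v)
    (u' := fun v => cb + d + dI h v - f v - d / 2 * 1) le_rfl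
    ((continuousOn_unitSlopeFlux hf hh).sub (by fun_prop))
    (fun v hv => lt_of_lt_of_le (by have := hv.1; positivity) (hu v (Ioo_subset_Ioc_self hv)))
    (le_trans (by positivity) (hu 1 ⟨zero_lt_one, le_rfl⟩))
    (fun v hv => (hasDerivAt_unitSlopeFlux hf hh hv).sub ((hasDerivAt_id v).const_mul _))
    (fun v hv => ?_) 0 (left_mem_Icc.2 zero_le_one)
  · simp only [unitSlopeFlux_zero hh, mul_zero, sub_zero] at hle
    exact le_antisymm hle (hw.nonneg (left_mem_Icc.2 zero_le_one))
  · have hv0 := hv.1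
    have hu0 : 0 < d / 2 * v := by positivity
    have huv := hu v (Ioo_subset_Ioc_self hv)
    set u := unitSlopeFlux f h (cb + d) v - d / 2 * v
    have hfv := hf.pos v hv
    have h1 : f v * invSlope ε u ≤ f v * (1 + ε / u) :=
      mul_le_mul_of_nonneg_left (invSlope_le hε (hu0.trans_le huv)) hfv.le
    have h2 : f v * (ε / u) ≤ d / 2 := by
      rw [← mul_div_assoc, div_le_iff₀ (hu0.trans_le huv)]
      calc f v * ε ≤ k * v * ε := by gcongr; exact hk v (Ioo_subset_Icc_self hv)
        _ = ε * k * v := by ring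
        _ ≤ d ^ 2 / 4 * v := by gcongr
        _ = d / 2 * (d / 2 * v) := by ring
        _ ≤ d / 2 * u := by gcongr
    linarith

theorem isLeast_criticalSpeed (hf : ReactionF f) (hh : ConvectionH h) (hε : 0 < ε) :
    IsLeast {c | IsAdmissible f h ε c} (criticalSpeed f h ε) := by
  have hbdd : BddBelow {c | IsAdmissible f h ε c} :=
    ⟨0, fun c hc => S_zero (f := f) (h := h) ▸ hc.S_le hf hh hε (left_mem_Icc.2 zero_le_one)⟩
  have hne : {c | IsAdmissible f h ε c}.Nonempty := by
    obtain ⟨cb, hcb⟩ := isCompact_Icc.bddAbove_image (continuousOn_S hf hh)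
    obtain ⟨k, hk0, hk⟩ := hf.bound
    refine ⟨cb + (ε * k + 1) * 2, isAdmissible_add hf hh hε (fun s hs => (hk s hs).1)
      (fun v hv => hcb (mem_image_of_mem _ (Ioc_subset_Icc_self hv))) (by positivity) ?_⟩
    nlinarith [mul_pos hε hk0]
  refine ⟨?_, fun c hc => csInf_le hbdd hc⟩
  obtain ⟨w, hw⟩ := exists_isFlux hf hh hε (criticalSpeed f h ε)
  refine (isAdmissible_iff hε hf hh).2 ⟨w, hw, ?_⟩
  have h0I : (0 : ℝ) ∈ Icc (0 : ℝ) 1 := left_mem_Icc.2 zero_le_one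
  refine le_antisymm ?_ (hw.nonneg h0I)
  by_contra! hpos
  obtain ⟨c, hc, hlt⟩ := exists_lt_of_csInf_lt hne
    (show sInf {c | IsAdmissible f h ε c} < criticalSpeed f h ε + w 0 by
      exact lt_add_of_pos_right _ hpos)
  obtain ⟨wc, hwc, hwc0⟩ := (isAdmissible_iff hε hf hh).1 hc
  have := hw.le_add_of_le hf hwc (csInf_le hbdd hc) h0I
  rw [hwc0] at this
  linarith

/-- If `cb` is the maximum of `S` over `[0,1]`, then the critical speed lies in the interval
`[cb, cb + 2 √(ε k)]`. -/
theorem tendsto_criticalSpeed (hf : ReactionF f) (hh : ConvectionH h) {vp : ℝ}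
    (hvp : vp ∈ Icc (0 : ℝ) 1) (hS : ∀ v ∈ Ioc (0 : ℝ) 1, S f h v ≤ S f h vp) :
    Tendsto (criticalSpeed f h) (𝓝[>] 0) (𝓝 (S f h vp)) := by
  obtain ⟨k, hk0, hk⟩ := hf.bound
  have h1 : Tendsto (fun ε => S f h vp + 2 * √(ε * k)) (𝓝[>] 0) (𝓝 (S f h vp)) := by
    have : Continuous fun ε => S f h vp + 2 * √(ε * k) := by fun_prop
    simpa using (this.tendsto 0).mono_left nhdsWithin_le_nhds
  refine tendsto_of_tendsto_of_tendsto_of_le_of_le' tendsto_const_nhds h1 ?_ ?_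
  · filter_upwards [self_mem_nhdsWithin] with ε hε
    exact (isLeast_criticalSpeed hf hh hε).1.S_le hf hh hε hvp
  · filter_upwards [self_mem_nhdsWithin] with ε hε
    have hε : 0 < ε := hε
    refine (isLeast_criticalSpeed hf hh hε).2 (isAdmissible_add hf hh hε
      (fun s hs => (hk s hs).1) hS (by positivity) ?_)
    rw [mul_pow, Real.sq_sqrt (by positivity)]
    linarith

end speed

/-! ### Fronts -/

section range

variable {τ T : ℝ → ℝ} {a κ z v : ℝ}

/-- A slope `O(1 - v)` makes the travel time to height `1` infinite. -/
theorem exists_lt_travelTime (hτ : ContinuousOn τ (Ioo 0 1)) (ha : a ∈ Ioo (0 : ℝ) 1) (hκ : 0 < κ)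
    (h : ∀ s ∈ Ioo a 1, κ / (1 - s) ≤ τ s) (z : ℝ) : ∃ v ∈ Ioo (0 : ℝ) 1, z < travelTime τ v := by
  have hsub : Ico a 1 ⊆ Ioo 0 1 := fun x hx => ⟨ha.1.trans_le hx.1, hx.2⟩
  have hm : MonotoneOn (fun v => travelTime τ v + κ * Real.log (1 - v)) (Ico a 1) := by
    have hd : ∀ x ∈ Ico a 1, HasDerivAt (fun v => travelTime τ v + κ * Real.log (1 - v))
        (τ x + κ * (-1 / (1 - x))) x := fun x hx =>
      (hasDerivAt_travelTime hτ (hsub hx)).add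
        ((((hasDerivAt_id x).const_sub 1).log (sub_pos.2 hx.2).ne').const_mul κ)
    refine monotoneOn_of_hasDerivAt_nonneg (g' := fun x => τ x + κ * (-1 / (1 - x)))
      (convex_Ico a 1) (fun x hx => (hd x hx).continuousAt.continuousWithinAt) ?_ ?_ <;>
      rw [interior_Ico]
    · exact fun x hx => hd x (Ioo_subset_Ico_self hx)
    · intro x hx
      have := h x hx
      have h2 : κ * (-1 / (1 - x)) = -(κ / (1 - x)) := by ring
      linarith
  have h1a : 0 < 1 - a := sub_pos.2 ha.2
  set M := (|z - travelTime τ a| + 1) / κ with hM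
  have hM0 : 0 ≤ M := by positivity
  have hv : 1 - (1 - a) * Real.exp (-M) ∈ Ico a 1 := by
    have h1 : Real.exp (-M) ≤ 1 := Real.exp_le_one_iff.2 (by linarith)
    have h2 := Real.exp_pos (-M)
    exact ⟨by nlinarith, by nlinarith⟩
  refine ⟨_, hsub hv, ?_⟩
  have := hm ⟨le_rfl, ha.2⟩ hv hv.1
  simp only [sub_sub_cancel] at this
  rw [Real.log_mul h1a.ne' (Real.exp_pos _).ne', Real.log_exp] at this
  have hκM : κ * M = |z - travelTime τ a| + 1 := by rw [hM]; field_simp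
  have := le_abs_self (z - travelTime τ a)
  linarith

/-- A slope `O(v)` makes the travel time from height `0` infinite. -/
theorem exists_travelTime_lt (hτ : ContinuousOn τ (Ioo 0 1)) (ha : a ∈ Ioo (0 : ℝ) 1) (hκ : 0 < κ)
    (h : ∀ s ∈ Ioo 0 a, κ / s ≤ τ s) (z : ℝ) : ∃ v ∈ Ioo (0 : ℝ) 1, travelTime τ v < z := by
  have hsub : Ioc 0 a ⊆ Ioo 0 1 := fun x hx => ⟨hx.1, hx.2.trans_lt ha.2⟩
  have hm : MonotoneOn (fun v => travelTime τ v - κ * Real.log v) (Ioc 0 a) := by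
    have hd : ∀ x ∈ Ioc 0 a, HasDerivAt (fun v => travelTime τ v - κ * Real.log v)
        (τ x - κ * x⁻¹) x := fun x hx =>
      (hasDerivAt_travelTime hτ (hsub hx)).sub ((Real.hasDerivAt_log hx.1.ne').const_mul κ)
    refine monotoneOn_of_hasDerivAt_nonneg (g' := fun x => τ x - κ * x⁻¹)
      (convex_Ioc 0 a) (fun x hx => (hd x hx).continuousAt.continuousWithinAt) ?_ ?_ <;>
      rw [interior_Ioc]
    · exact fun x hx => hd x (Ioo_subset_Ioc_self hx)
    · intro x hx
      have := h x hx
      rw [div_eq_mul_inv] at this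
      linarith
  set M := (|z - travelTime τ a| + 1) / κ with hM
  have hM0 : 0 ≤ M := by positivity
  have hv : a * Real.exp (-M) ∈ Ioc 0 a := by
    have h1 : Real.exp (-M) ≤ 1 := Real.exp_le_one_iff.2 (by linarith)
    have h2 := Real.exp_pos (-M)
    exact ⟨mul_pos ha.1 h2, by nlinarith [ha.1]⟩
  refine ⟨_, hsub hv, ?_⟩
  have := hm hv ⟨ha.1, le_rfl⟩ hv.2
  simp only at this
  rw [Real.log_mul ha.1.ne' (Real.exp_pos _).ne', Real.log_exp] at this
  have hκM : κ * M = |z - travelTime τ a| + 1 := by rw [hM]; field_simp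
  have := neg_abs_le (z - travelTime τ a)
  linarith

theorem IsTravelTime.heightAt_lt_one (hT : IsTravelTime T) (h : ∃ v ∈ Ioo (0 : ℝ) 1, z < T v) :
    heightAt T z < 1 := by
  obtain ⟨v, hv, hz⟩ := h
  refine lt_of_le_of_lt ?_ hv.2
  by_contra! hlt
  exact (hT.lt_of_lt_heightAt hv hlt).not_gt hz

theorem heightAt_pos (h : ∃ v ∈ Ioo (0 : ℝ) 1, T v < z) : 0 < heightAt T z := by
  obtain ⟨v, hv, hz⟩ := h
  refine hv.1.trans_le ?_
  by_contra! hlt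
  exact (lt_of_heightAt_lt hv hlt).not_gt hz

theorem travelTime_half : travelTime τ (1 / 2) = 0 := intervalIntegral.integral_same

end range

section fronts

variable {f h w u : ℝ → ℝ} {ε c v : ℝ}

theorem IsFlux.continuousOn_invSlope (hw : IsFlux f h ε c w) :
    ContinuousOn (fun v => invSlope ε (w v)) (Ioo 0 1) := fun v hv =>
  ((continuousAt_invSlope (hw.pos v hv)).comp
    (hw.hasDeriv v hv).continuousAt).continuousWithinAt

theorem IsFlux.isTravelTime (hw : IsFlux f h ε c w) :
    IsTravelTime (travelTime fun v => invSlope ε (w v)) :=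
  isTravelTime_travelTime hw.continuousOn_invSlope fun v hv => one_le_invSlope (hw.pos v hv)

theorem IsFlux.exists_le_mul_one_sub (hf : ReactionF f) (hh : ConvectionH h) (hε : 0 < ε)
    (hw : IsFlux f h ε c w) : ∃ C > 0, ∀ v ∈ Icc (0 : ℝ) 1, w v ≤ C * (1 - v) := by
  obtain ⟨K, hK⟩ := isCompact_Icc.exists_bound_of_continuousOn
    (continuousOn_const.add hh.continuousOn_dI : ContinuousOn (fun v => c + dI h v) (Icc 0 1))
  have hK0 : 0 ≤ K := (norm_nonneg _).trans (hK 0 (left_mem_Icc.2 zero_le_one))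
  obtain ⟨k, hk0, hk⟩ := hf.bound
  set C := K + k + k * ε + 1 with hC
  have hC1 : 1 ≤ C := by rw [hC]; nlinarith [mul_pos hk0 hε]
  have hC0 : 0 < C := zero_lt_one.trans_le hC1
  refine ⟨C, hC0, ?_⟩
  refine hw.le_of_supersolution hf (u' := fun _ => C * (-1)) le_rfl (by fun_prop)
    (fun v hv => mul_pos hC0 (sub_pos.2 hv.2)) (by simp)
    (fun v _ => ((hasDerivAt_id v).const_sub 1).const_mul C) fun v hv => ?_
  have hv' := Ioo_subset_Icc_self hv
  have h1v : 0 < 1 - v := sub_pos.2 hv.2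
  have h1 : f v * invSlope ε (C * (1 - v)) ≤ k * (1 - v) * (1 + ε / (C * (1 - v))) :=
    mul_le_mul (hk v hv').2 (invSlope_le hε (by positivity)) (invSlope_pos (by positivity)).le
      (by positivity)
  have h2 : k * (1 - v) * (1 + ε / (C * (1 - v))) = k * (1 - v) + k * ε / C := by
    field_simp
  have h3 : k * ε / C ≤ k * ε := div_le_self (by positivity) hC1
  have h4 : k * (1 - v) ≤ k := by nlinarith [hv.1]
  have h5 : -K ≤ c + dI h v := (abs_le.1 (hK v hv')).1
  linarith

theorem IsFlux.exists_le_mul (hf : ReactionF f) (hh : ConvectionH h)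
    (hw : IsFlux f h ε c w) (h0 : w 0 = 0) : ∃ C > 0, ∀ v ∈ Icc (0 : ℝ) 1, w v ≤ C * v := by
  have hcont : ContinuousOn (fun v => c + dI h v - f v) (Icc 0 1) :=
    (continuousOn_const.add hh.continuousOn_dI).sub hf.continuousOn
  obtain ⟨K, hK⟩ := isCompact_Icc.exists_bound_of_continuousOn hcont
  have h0I : (0 : ℝ) ∈ Icc (0 : ℝ) 1 := left_mem_Icc.2 zero_le_one
  have hK0 : 0 ≤ K := (norm_nonneg _).trans (hK 0 h0I)
  refine ⟨K + 1, by linarith, fun v hv => ?_⟩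
  have h1 := (convex_Icc (0 : ℝ) 1).norm_image_sub_le_of_norm_hasDerivWithin_le
    (fun v hv => hasDerivWithinAt_unitSlopeFlux (c := c) hf hh hv) hK h0I hv
  rw [unitSlopeFlux_zero hh, sub_zero, sub_zero, Real.norm_of_nonneg hv.1] at h1
  linarith [hw.le_unitSlopeFlux hf hh h0 hv, (le_abs_self _).trans h1, hv.1]

/-- The front of flux `w` takes infinite time to reach the heights `0` and `1`. -/
theorem IsFlux.heightAt_mem_Ioo (hf : ReactionF f) (hh : ConvectionH h) (hε : 0 < ε)
    (hw : IsFlux f h ε c w) (h0 : w 0 = 0) (z : ℝ) :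
    heightAt (travelTime fun v => invSlope ε (w v)) z ∈ Ioo (0 : ℝ) 1 := by
  have hhalf : (1 / 2 : ℝ) ∈ Ioo (0 : ℝ) 1 := by norm_num
  constructor
  · obtain ⟨C, hC, hle⟩ := hw.exists_le_mul hf hh h0
    refine heightAt_pos (exists_travelTime_lt hw.continuousOn_invSlope hhalf (div_pos hε hC) ?_ z)
    intro s hs
    have hs' : s ∈ Ioo (0 : ℝ) 1 := ⟨hs.1, hs.2.trans hhalf.2⟩
    have hwp := hw.pos s hs'
    refine le_trans ?_ (div_le_invSlope hwp)
    rw [div_div]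
    have := hle s (Ioo_subset_Icc_self hs')
    gcongr
  · obtain ⟨C, hC, hle⟩ := hw.exists_le_mul_one_sub hf hh hε
    refine hw.isTravelTime.heightAt_lt_one
      (exists_lt_travelTime hw.continuousOn_invSlope hhalf (div_pos hε hC) ?_ z)
    intro s hs
    have hs' : s ∈ Ioo (0 : ℝ) 1 := ⟨hhalf.1.trans hs.1, hs.2⟩
    have hwp := hw.pos s hs'
    refine le_trans ?_ (div_le_invSlope hwp)
    rw [div_div]
    have := hle s (Ioo_subset_Icc_self hs')
    gcongr

theorem IsFlux.isFrontProfile (hf : ReactionF f) (hh : ConvectionH h) (hε : 0 < ε)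
    (hw : IsFlux f h ε c w) (h0 : w 0 = 0) :
    IsFrontProfile f h ε c (heightAt (travelTime fun v => invSlope ε (w v))) := by
  set T := travelTime fun v => invSlope ε (w v) with hTdef
  have hT : IsTravelTime T := hw.isTravelTime
  set u := heightAt T with hu
  have hmem : ∀ z, u z ∈ Ioo (0 : ℝ) 1 := hw.heightAt_mem_Ioo hf hh hε h0
  set ψ : ℝ → ℝ := fun x => x / √(ε ^ 2 + x ^ 2) with hψ
  have hrpos : ∀ x : ℝ, 0 < √(ε ^ 2 + x ^ 2) := fun x => by positivity
  have hψQ : ∀ x, (invSlope ε x)⁻¹ = ψ x := fun x => inv_div _ _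
  have hud : ∀ z, HasDerivAt u (ψ (w (u z))) z := fun z => by
    have := hT.hasDerivAt_heightAt (hmem z) (hasDerivAt_travelTime hw.continuousOn_invSlope (hmem z))
      (invSlope_pos (hw.pos _ (hmem z))).ne'
    rwa [hψQ] at this
  have huc : Continuous u := hT.continuous_heightAt
  have hderiv : deriv u = fun z => ψ (w (u z)) := funext fun z => (hud z).deriv
  have hwd : ∀ z, HasDerivAt (fun z => w (u z))
      ((c + dI h (u z) - f (u z) * invSlope ε (w (u z))) * ψ (w (u z))) z := fun z =>
    (hw.hasDeriv _ (hmem z)).comp z (hud z)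
  have hψc : ContDiff ℝ 1 ψ := by
    refine contDiff_id.div (ContDiff.sqrt (by fun_prop) fun x => by positivity)
      fun x => (hrpos x).ne'
  have hwc : Continuous fun z => w (u z) :=
    continuous_iff_continuousAt.2 fun z => (hwd z).continuousAt
  have hcomp : ∀ {g : ℝ → ℝ}, ContinuousOn g (Icc 0 1) → Continuous fun z => g (u z) :=
    fun hg => hg.comp_continuous huc fun z => Ioo_subset_Icc_self (hmem z)
  have hwC : ContDiff ℝ 1 fun z => w (u z) := by
    refine contDiff_one_iff_deriv.2 ⟨fun z => (hwd z).differentiableAt, ?_⟩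
    rw [show deriv (fun z => w (u z)) = _ from funext fun z => (hwd z).deriv]
    have h1 : Continuous fun z => invSlope ε (w (u z)) := continuous_iff_continuousAt.2 fun z =>
      ContinuousAt.comp (f := fun z => w (u z)) (g := invSlope ε)
        (continuousAt_invSlope (hw.pos _ (hmem z))) (hwd z).continuousAt
    exact ((continuous_const.add (hcomp hh.continuousOn_dI)).sub
      ((hcomp hf.continuousOn).mul h1)).mul (hψc.continuous.comp hwc)
  have hψ1 : ∀ x, 1 - ψ x ^ 2 = (ε / √(ε ^ 2 + x ^ 2)) ^ 2 := fun x => by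
    have := hrpos x
    simp only [hψ]
    rw [div_pow, div_pow, Real.sq_sqrt (by positivity)]
    field_simp
    ring
  refine ⟨?_, fun z => ?_, fun z => ?_, fun z => ?_, ?_, ?_, ?_⟩
  · rw [show (2 : WithTop ℕ∞) = 1 + 1 by norm_num, contDiff_succ_iff_deriv]
    refine ⟨fun z => (hud z).differentiableAt, by simp, ?_⟩
    rw [hderiv]
    exact hψc.comp hwC
  · rw [hderiv]
    exact div_pos (hw.pos _ (hmem z)) (hrpos _)
  · rw [hderiv]
    have h1 : 0 < (ε / √(ε ^ 2 + w (u z) ^ 2)) ^ 2 := by have := hrpos (w (u z)); positivity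
    rw [← hψ1] at h1
    exact (abs_lt.1 ((sq_lt_one_iff_abs_lt_one _).1 (sub_pos.1 h1))).2
  · have h1 : (fun x => deriv u x / √(1 - deriv u x ^ 2)) = fun x => w (u x) / ε := by
      funext x
      have := hrpos (w (u x))
      rw [hderiv]
      simp only
      rw [hψ1, Real.sqrt_sq (by positivity)]
      simp only [hψ]
      field_simp
    rw [h1, ((hwd z).div_const ε).deriv, hderiv, mul_div_cancel₀ _ hε.ne']
    have h2 : invSlope ε (w (u z)) * ψ (w (u z)) = 1 := by
      rw [← hψQ, mul_inv_cancel₀ (invSlope_pos (hw.pos _ (hmem z))).ne']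
    linear_combination -f (u z) * h2
  · rw [tendsto_order]
    refine ⟨fun a ha => Eventually.of_forall fun z => ha.trans (hmem z).1, fun a ha => ?_⟩
    obtain ⟨b, hb0, hb⟩ := exists_between (lt_min ha zero_lt_one)
    have hbI : b ∈ Ioo (0 : ℝ) 1 := ⟨hb0, hb.trans_le (min_le_right _ _)⟩
    filter_upwards [eventually_le_atBot (T b)] with z hz
    refine lt_of_le_of_lt ?_ (hb.trans_le (min_le_left _ _))
    exact (monotone_heightAt T hz).trans_eq (hT.heightAt_eq hbI rfl)
  · rw [tendsto_order]
    refine ⟨fun a ha => ?_, fun a ha => Eventually.of_forall fun z => (hmem z).2.trans ha⟩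
    obtain ⟨b, hb, hb1⟩ := exists_between (max_lt ha zero_lt_one)
    have hbI : b ∈ Ioo (0 : ℝ) 1 := ⟨(le_max_right _ _).trans_lt hb, hb1⟩
    filter_upwards [eventually_ge_atTop (T b)] with z hz
    refine ((le_max_left _ _).trans_lt hb).trans_le ?_
    exact (hT.heightAt_eq hbI rfl).symm.trans_le (monotone_heightAt T hz)
  · exact hT.heightAt_eq (by norm_num) travelTime_half

theorem IsFrontProfile.mem_Ioo (hu : IsFrontProfile f h ε c u) (z : ℝ) :
    u z ∈ Ioo (0 : ℝ) 1 := by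
  have hm : StrictMono u := strictMono_of_deriv_pos hu.deriv_pos
  exact ⟨(hm.monotone.le_of_tendsto hu.tendsto_atBot (z - 1)).trans_lt (hm (by linarith)),
    (hm (by linarith)).trans_le (hm.monotone.ge_of_tendsto hu.tendsto_atTop (z + 1))⟩

theorem le_of_deriv_nonneg_of_pos {D D' : ℝ → ℝ} (hD : ∀ z, HasDerivAt D (D' z) z)
    (h : ∀ z, 0 < D z → 0 ≤ D' z) {z₀ z : ℝ} (h0 : 0 < D z₀) (hz : z₀ ≤ z) : D z₀ ≤ D z := by
  have hc : Continuous D := continuous_iff_continuousAt.2 fun z => (hD z).continuousAt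
  have := le_of_deriv_le_of_lt (a := z₀) (b := z) (w := D) (u := fun _ => max (D z) 0)
    (u' := fun _ => 0) hc.continuousOn continuousOn_const (fun x _ => hD x)
    (fun x _ => hasDerivAt_const x _) (le_max_left _ _)
    (fun x _ hx => h x ((le_max_right _ _).trans_lt hx)) z₀ ⟨le_rfl, hz⟩
  rcases le_max_iff.1 this with h1 | h1
  · exact h1
  · exact absurd h1 h0.not_ge

/-- The flux of any front profile is the flux `w`, whence its travel time is determined. Indeed,
the difference `D` of the two fluxes cannot decrease while it is positive nor increase while it is
negative. If it is positive somewhere, the slope of the front stays away from `0`; if it is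
negative somewhere, `w` stays away from `0` along the front. Neither is possible near `z = ∞`. -/
theorem IsFrontProfile.travelTime_eq (hf : ReactionF f) (hε : 0 < ε)
    (hu : IsFrontProfile f h ε c u) (hw : IsFlux f h ε c w) (z : ℝ) :
    travelTime (fun v => invSlope ε (w v)) (u z) = z := by
  have hmem := hu.mem_Ioo
  have hud : ∀ z, HasDerivAt u (deriv u z) z := fun z =>
    (hu.contDiff.differentiable (by norm_num) z).hasDerivAt
  have hu'd : Differentiable ℝ (deriv u) := by
    have := hu.contDiff
    rw [show (2 : WithTop ℕ∞) = 1 + 1 by norm_num, contDiff_succ_iff_deriv] at this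
    exact this.2.2.differentiable one_ne_zero
  have hpos : ∀ z, 0 < 1 - deriv u z ^ 2 := fun z => by
    nlinarith [hu.deriv_pos z, hu.deriv_lt_one z]
  set φ : ℝ → ℝ := fun z => ε * (deriv u z / √(1 - deriv u z ^ 2)) with hφ
  have hφpos : ∀ z, 0 < φ z := fun z =>
    mul_pos hε (div_pos (hu.deriv_pos z) (Real.sqrt_pos.2 (hpos z)))
  have hφQ : ∀ z, invSlope ε (φ z) = (deriv u z)⁻¹ := fun z => by
    have h1 := Real.sqrt_pos.2 (hpos z)
    have h2 : ε ^ 2 + φ z ^ 2 = (ε / √(1 - deriv u z ^ 2)) ^ 2 := by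
      simp only [hφ]
      rw [mul_pow, div_pow, div_pow, Real.sq_sqrt (hpos z).le]
      have := hpos z
      field_simp
      ring
    have h3 := hu.deriv_pos z
    rw [invSlope, h2, Real.sqrt_sq (by positivity)]
    simp only [hφ]
    field_simp
  have hφd : ∀ z, HasDerivAt φ ((c + dI h (u z)) * deriv u z - f (u z)) z := fun z => by
    have h1 : DifferentiableAt ℝ (fun x => deriv u x / √(1 - deriv u x ^ 2)) z :=
      (hu'd z).div (((hu'd z).pow 2).const_sub 1 |>.sqrt (hpos z).ne') (Real.sqrt_pos.2 (hpos z)).ne'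
    refine (h1.hasDerivAt.const_mul ε).congr_deriv ?_
    linarith [hu.equation z]
  have hwd : ∀ z, HasDerivAt (fun z => w (u z))
      ((c + dI h (u z) - f (u z) * invSlope ε (w (u z))) * deriv u z) z := fun z =>
    (hw.hasDeriv _ (hmem z)).comp z (hud z)
  set D' : ℝ → ℝ := fun z => (c + dI h (u z)) * deriv u z - f (u z)
    - (c + dI h (u z) - f (u z) * invSlope ε (w (u z))) * deriv u z with hD'
  have hD'eq : ∀ z, D' z = f (u z) * deriv u z * (invSlope ε (w (u z)) - invSlope ε (φ z)) :=
    fun z => by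
      have := hu.deriv_pos z
      rw [hφQ]
      simp only [hD']
      field_simp
      ring
  have hfu : ∀ z, 0 < f (u z) * deriv u z := fun z => mul_pos (hf.pos _ (hmem z)) (hu.deriv_pos z)
  have heq : ∀ z, φ z = w (u z) := by
    intro z₀
    rcases lt_trichotomy (φ z₀) (w (u z₀)) with hlt | heq | hgt
    · exfalso
      have hstay : ∀ z, z₀ ≤ z → w (u z₀) - φ z₀ ≤ w (u z) := fun z hz => by
        have := le_of_deriv_nonneg_of_pos (D := fun z => w (u z) - φ z) (D' := fun z => -D' z)
          (fun z => ((hwd z).sub (hφd z)).congr_deriv (by simp only [hD']; ring))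
          (fun z hz => ?_) (sub_pos.2 hlt) hz
        · linarith [hφpos z]
        · rw [hD'eq]
          have := invSlope_anti (ε := ε) (hφpos z) (sub_pos.1 hz).le
          nlinarith [hfu z]
      have h1 : Tendsto (fun z => w (u z)) atTop (𝓝 0) := by
        have h2 := hw.continuousOn 1 (right_mem_Icc.2 zero_le_one)
        rw [ContinuousWithinAt, hw.one] at h2
        exact h2.comp (tendsto_nhdsWithin_iff.2 ⟨hu.tendsto_atTop,
          Eventually.of_forall fun z => Ioo_subset_Icc_self (hmem z)⟩)
      have := ge_of_tendsto h1 ((eventually_ge_atTop z₀).mono hstay)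
      linarith
    · exact heq
    · exfalso
      set d := φ z₀ - w (u z₀) with hd
      have hd0 : 0 < d := sub_pos.2 hgt
      have hstay : ∀ z, z₀ ≤ z → d ≤ φ z := fun z hz => by
        have := le_of_deriv_nonneg_of_pos (D := fun z => φ z - w (u z)) (D' := D')
          (fun z => (hφd z).sub (hwd z)) (fun z hz => ?_) hd0 hz
        · linarith [hw.pos _ (hmem z)]
        · rw [hD'eq]
          have := invSlope_anti (ε := ε) (hw.pos _ (hmem z)) (sub_pos.1 hz).le
          exact mul_nonneg (hfu z).le (sub_nonneg.2 this)
      set m := (invSlope ε d)⁻¹ with hm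
      have hm0 : 0 < m := inv_pos.2 (invSlope_pos hd0)
      have hslope : ∀ z, z₀ ≤ z → m ≤ deriv u z := fun z hz => by
        have h1 := invSlope_anti (ε := ε) hd0 (hstay z hz)
        rw [hφQ] at h1
        exact inv_le_of_inv_le₀ (hu.deriv_pos z) h1
      have hmono := monotoneOn_of_hasDerivAt_nonneg (convex_Ici z₀) (g := fun z => u z - m * z)
        (g' := fun z => deriv u z - m * 1)
        (fun z _ => ((hud z).sub ((hasDerivAt_id z).const_mul m)).continuousAt.continuousWithinAt)
        (fun z _ => (hud z).sub ((hasDerivAt_id z).const_mul m))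
        (fun z hz => by rw [interior_Ici] at hz; linarith [hslope z hz.le])
      have hle : z₀ ≤ z₀ + 1 / m := by have := one_div_pos.2 hm0; linarith
      have := hmono (mem_Ici.2 le_rfl) (mem_Ici.2 hle) hle
      simp only [mul_add, mul_one_div_cancel hm0.ne'] at this
      linarith [(hmem z₀).1, (hmem (z₀ + 1 / m)).2]
  have hTd : ∀ z, HasDerivAt (fun z => travelTime (fun v => invSlope ε (w v)) (u z) - z) 0 z := by
    intro z
    have h1 := ((hasDerivAt_travelTime hw.continuousOn_invSlope (hmem z)).comp z (hud z)).sub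
      (hasDerivAt_id z)
    refine h1.congr_deriv ?_
    rw [← heq, hφQ, inv_mul_cancel₀ (hu.deriv_pos z).ne', sub_self]
  have := is_const_of_deriv_eq_zero (fun z => (hTd z).differentiableAt) (fun z => (hTd z).deriv) z 0
  rw [hu.normalized, travelTime_half] at this
  linarith

theorem existsUnique_isFrontProfile (hf : ReactionF f) (hh : ConvectionH h) (hε : 0 < ε)
    (hc : IsAdmissible f h ε c) : ∃! u, IsFrontProfile f h ε c u := by
  obtain ⟨w, hw, h0⟩ := (isAdmissible_iff hε hf hh).1 hc
  refine ⟨_, hw.isFrontProfile hf hh hε h0, fun u hu => funext fun z => ?_⟩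
  exact (hw.isTravelTime.heightAt_eq (hu.mem_Ioo z) (hu.travelTime_eq hf hε hw z)).symm

theorem isFrontProfile_criticalProfile (hf : ReactionF f) (hh : ConvectionH h) (hε : 0 < ε) :
    IsFrontProfile f h ε (criticalSpeed f h ε) (criticalProfile f h ε) :=
  Classical.epsilon_spec
    (existsUnique_isFrontProfile hf hh hε (isLeast_criticalSpeed hf hh hε).1).exists

end fronts

/-! ### The vanishing diffusion limit -/

/-- The height `vp` separates the two regimes of the limit front: `S` attains its maximum over
`[0,1]` at `vp`, and above `vp` the flux of the limit front vanishes, since there `f - h'` stays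
below the limit speed `S(vp)`. The extreme cases `vp = 0` and `vp = 1` are allowed. -/
structure IsTransition (f h : ℝ → ℝ) (vp : ℝ) : Prop where
  mem : vp ∈ Icc (0 : ℝ) 1
  S_le : ∀ v ∈ Ioc (0 : ℝ) 1, S f h v ≤ S f h vp
  lt : ∀ v ∈ Ioc vp 1, f v - dI h v < S f h vp

/-- The reciprocal slope of the limit front: the slope is `1` below the transition `vp`, and is the
inviscid slope `f / (c + h')` with `c = S(vp)` above it. -/
noncomputable def limitInvSlope (f h : ℝ → ℝ) (vp v : ℝ) : ℝ :=
  if v ≤ vp then 1 else (S f h vp + dI h v) / f v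

section limit

variable {f h : ℝ → ℝ} {vp v : ℝ}

theorem S_eq_of_isMax (hf : ReactionF f) (hh : ConvectionH h) (hvp : vp ∈ Ioo (0 : ℝ) 1)
    (hS : ∀ v ∈ Ioc (0 : ℝ) 1, S f h v ≤ S f h vp) : S f h vp = f vp - dI h vp := by
  have h1 := (hasDerivWithinAt_S hf hh (Ioo_subset_Ioc_self hvp)).hasDerivAt
    (Icc_mem_nhds hvp.1 hvp.2)
  have h2 : IsLocalMax (S f h) vp := by
    filter_upwards [Ioc_mem_nhds hvp.1 hvp.2] with v hv using hS v hv
  have h3 := h2.hasDerivAt_eq_zero h1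
  rw [div_eq_zero_iff] at h3
  rcases h3 with h3 | h3
  · linarith
  · exact absurd h3 hvp.1.ne'

theorem IsTransition.le_add (hf : ReactionF f) (hh : ConvectionH h) (ht : IsTransition f h vp)
    (hv : v ∈ Ioo (0 : ℝ) 1) (hle : vp ≤ v) : f v ≤ S f h vp + dI h v := by
  rcases hle.eq_or_lt with rfl | hlt
  · linarith [S_eq_of_isMax hf hh hv ht.S_le]
  · linarith [ht.lt v ⟨hlt, hv.2.le⟩]

theorem IsTransition.limitInvSlope_of_le (hf : ReactionF f) (hh : ConvectionH h)
    (ht : IsTransition f h vp) (hv : v ∈ Ioo (0 : ℝ) 1) (hle : vp ≤ v) :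
    limitInvSlope f h vp v = (S f h vp + dI h v) / f v := by
  unfold limitInvSlope
  split_ifs with hle'
  · obtain rfl := le_antisymm hle hle'
    rw [S_eq_of_isMax hf hh hv ht.S_le, sub_add_cancel, div_self (hf.pos _ hv).ne']
  · rfl

theorem limitInvSlope_of_ge (hle : v ≤ vp) : limitInvSlope f h vp v = 1 := if_pos hle

theorem IsTransition.one_le_limitInvSlope (hf : ReactionF f) (hh : ConvectionH h)
    (ht : IsTransition f h vp) (hv : v ∈ Ioo (0 : ℝ) 1) : 1 ≤ limitInvSlope f h vp v := by
  rcases le_total v vp with hle | hle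
  · exact (limitInvSlope_of_ge hle).ge
  · rw [ht.limitInvSlope_of_le hf hh hv hle, one_le_div (hf.pos v hv)]
    exact ht.le_add hf hh hv hle

theorem continuousOn_add_div (hf : ReactionF f) (hh : ConvectionH h) (c : ℝ) :
    ContinuousOn (fun v => (c + dI h v) / f v) (Ioo 0 1) :=
  (continuousOn_const.add (hh.continuousOn_dI.mono Ioo_subset_Icc_self)).div
    (hf.continuousOn.mono Ioo_subset_Icc_self) fun v hv => (hf.pos v hv).ne'

theorem IsTransition.continuousOn_limitInvSlope (hf : ReactionF f) (hh : ConvectionH h)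
    (ht : IsTransition f h vp) : ContinuousOn (limitInvSlope f h vp) (Ioo 0 1) := by
  rcases ht.mem.2.eq_or_lt with rfl | h1
  · exact continuousOn_const.congr fun v hv => limitInvSlope_of_ge hv.2.le
  -- at heights in `(0,1)` the two expressions of the reciprocal slope agree at `vp`
  have hmax : ∀ v ∈ Ioo (0 : ℝ) 1, max v vp ∈ Ioo (0 : ℝ) 1 := fun v hv =>
    ⟨hv.1.trans_le (le_max_left _ _), max_lt hv.2 h1⟩
  have h2 : ContinuousOn
      (fun v => (S f h vp + dI h (max v vp)) / f (max v vp)) (Ioo 0 1) :=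
    (continuousOn_add_div hf hh (S f h vp)).comp (f := fun v => max v vp) (by fun_prop) hmax
  refine h2.congr fun v hv => ?_
  change _ = (S f h vp + dI h (max v vp)) / f (max v vp)
  rw [← ht.limitInvSlope_of_le hf hh (hmax v hv) (le_max_right _ _)]
  rcases le_total v vp with hle | hle
  · rw [max_eq_right hle, limitInvSlope_of_ge hle, limitInvSlope_of_ge le_rfl]
  · rw [max_eq_left hle]

theorem IsTransition.isTravelTime (hf : ReactionF f) (hh : ConvectionH h)
    (ht : IsTransition f h vp) : IsTravelTime (travelTime (limitInvSlope f h vp)) :=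
  isTravelTime_travelTime (ht.continuousOn_limitInvSlope hf hh)
    fun _ hv => ht.one_le_limitInvSlope hf hh hv

/-- The flux of the critical front converges to the flux of a front of slope `1` below the
transition, and to `0` above it. -/
theorem IsTransition.tendsto_flux (hf : ReactionF f) (hh : ConvectionH h)
    (ht : IsTransition f h vp) {W : ℝ → ℝ → ℝ}
    (hW : ∀ ε > 0, IsFlux f h ε (criticalSpeed f h ε) (W ε) ∧ W ε 0 = 0)
    (hv : v ∈ Ioo (0 : ℝ) 1) :
    Tendsto (fun ε => W ε v) (𝓝[>] 0) (𝓝 (unitSlopeFlux f h (S f h vp) (min v vp))) := by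
  have hcs := tendsto_criticalSpeed hf hh ht.mem ht.S_le
  have hP : ∀ x, Tendsto (fun ε => unitSlopeFlux f h (criticalSpeed f h ε) x) (𝓝[>] 0)
      (𝓝 (unitSlopeFlux f h (S f h vp) x)) := fun x =>
    ((hcs.mul_const x).add_const (h x)).sub_const (primitiveF f x)
  have hP0 : unitSlopeFlux f h (S f h vp) vp = 0 := by
    by_cases h0 : vp = 0
    · rw [h0, unitSlopeFlux_zero hh]
    · rw [unitSlopeFlux_eq h0, sub_self, mul_zero]
  have hv' := Ioo_subset_Icc_self hv
  rcases le_or_gt v vp with hle | hlt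
  · rw [min_eq_left hle]
    refine tendsto_of_tendsto_of_tendsto_of_le_of_le' (g := fun ε =>
      unitSlopeFlux f h (criticalSpeed f h ε) v - unitSlopeFlux f h (criticalSpeed f h ε) vp)
      (by simpa [hP0] using (hP v).sub (hP vp)) (hP v) ?_ ?_
    · filter_upwards [self_mem_nhdsWithin] with ε hε
      have h1 := (hW ε hε).1.sub_unitSlopeFlux_anti hf hh hv' ht.mem hle
      have h2 := (hW ε hε).1.nonneg ht.mem
      simp only at h1
      linarith
    · filter_upwards [self_mem_nhdsWithin] with ε hε
      exact (hW ε hε).1.le_unitSlopeFlux hf hh (hW ε hε).2 hv'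
  · rw [min_eq_right hlt.le, hP0, tendsto_order]
    refine ⟨fun a ha => ?_, fun a ha => ?_⟩
    · filter_upwards [self_mem_nhdsWithin] with ε hε
      exact ha.trans_le ((hW ε hε).1.nonneg hv')
    · have hsub : Icc v 1 ⊆ Icc 0 1 := Icc_subset_Icc_left hv.1.le
      obtain ⟨m, hm, hmax⟩ := isCompact_Icc.exists_isMaxOn (nonempty_Icc.2 hv.2.le)
        ((hf.continuousOn.sub hh.continuousOn_dI).mono hsub)
      obtain ⟨b, hb⟩ := isCompact_Icc.exists_bound_of_continuousOn hf.continuousOn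
      set κ := S f h vp - (f m - dI h m) with hκ
      have hκ0 : 0 < κ := sub_pos.2 (ht.lt m ⟨hlt.trans_le hm.1, hm.2⟩)
      have hsmall : ∀ᶠ ε in 𝓝[>] (0 : ℝ), b * (ε / (a / 2)) < κ := by
        have : Continuous fun ε : ℝ => b * (ε / (a / 2)) := by fun_prop
        have h0 := (this.tendsto 0).mono_left (nhdsWithin_le_nhds (s := Ioi 0))
        simp only [zero_div, mul_zero] at h0
        exact h0.eventually_lt_const hκ0
      filter_upwards [self_mem_nhdsWithin, hsmall] with ε hε hsm
      have hε : 0 < ε := hε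
      have ha2 : 0 < a / 2 := half_pos ha
      refine lt_of_le_of_lt ?_ (half_lt_self ha)
      refine (hW ε hε).1.le_of_supersolution hf (u' := fun _ => 0) hv.1.le continuousOn_const
        (fun _ _ => ha2) ha2.le (fun x _ => hasDerivAt_const x _) (fun x hx => ?_) v ⟨le_rfl, hv.2.le⟩
      have hx' := Ioo_subset_Icc_self hx
      have h1 := (isLeast_criticalSpeed hf hh hε).1.S_le hf hh hε ht.mem
      have h2 : f x - dI h x ≤ f m - dI h m := hmax hx'
      have h3 : f x * invSlope ε (a / 2) ≤ f x * (1 + ε / (a / 2)) :=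
        mul_le_mul_of_nonneg_left (invSlope_le hε ha2) (hf.nonneg (hsub hx'))
      have h4 : f x * (ε / (a / 2)) ≤ b * (ε / (a / 2)) :=
        mul_le_mul_of_nonneg_right ((le_abs_self _).trans (hb x (hsub hx'))) (by positivity)
      linarith

theorem ConvectionH.hasDerivAt (hh : ConvectionH h) (hv : v ∈ Ioo (0 : ℝ) 1) :
    HasDerivAt h (dI h v) v :=
  (hh.hasDerivWithinAt (Ioo_subset_Icc_self hv)).hasDerivAt (Icc_mem_nhds hv.1 hv.2)

theorem IsFlux.integral_mul_invSlope (hf : ReactionF f) (hh : ConvectionH h) {ε c : ℝ} {w : ℝ → ℝ}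
    (hw : IsFlux f h ε c w) {a b : ℝ} (ha : 0 < a) (hab : a ≤ b) (hb : b < 1) :
    ∫ s in a..b, f s * invSlope ε (w s) = (c * b + h b - w b) - (c * a + h a - w a) := by
  have hsub : uIcc a b ⊆ Ioo (0 : ℝ) 1 := by
    rw [uIcc_of_le hab]; exact fun x hx => ⟨ha.trans_le hx.1, hx.2.trans_lt hb⟩
  refine intervalIntegral.integral_eq_sub_of_hasDerivAt (f := fun s => c * s + h s - w s)
    (fun s hs => ?_) ?_
  · refine ((((hasDerivAt_id s).const_mul c).add (hh.hasDerivAt (hsub hs))).sub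
      (hw.hasDeriv s (hsub hs))).congr_deriv ?_
    ring
  · exact ((hf.continuousOn.mono (hsub.trans Ioo_subset_Icc_self)).mul
      (hw.continuousOn_invSlope.mono hsub)).intervalIntegrable

theorem IsTransition.integral_mul_limitInvSlope (hf : ReactionF f) (hh : ConvectionH h)
    (ht : IsTransition f h vp) {a b : ℝ} (ha : 0 < a) (hab : a ≤ b) (hb : b < 1) :
    ∫ s in a..b, f s * limitInvSlope f h vp s
      = (S f h vp * b + h b - unitSlopeFlux f h (S f h vp) (min b vp))
        - (S f h vp * a + h a - unitSlopeFlux f h (S f h vp) (min a vp)) := by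
  have hsub : Icc a b ⊆ Ioo (0 : ℝ) 1 := fun x hx => ⟨ha.trans_le hx.1, hx.2.trans_lt hb⟩
  have hvp := ht.mem
  refine MeasureTheory.integral_eq_of_hasDerivAt_off_countable_of_le
    (fun s => S f h vp * s + h s - unitSlopeFlux f h (S f h vp) (min s vp)) _ hab
    (countable_singleton vp) ?_ ?_ ?_
  · have h1 : ContinuousOn h (Icc a b) :=
      hh.contDiffOn.continuousOn.mono (hsub.trans Ioo_subset_Icc_self)
    have h2 : ContinuousOn (fun s => unitSlopeFlux f h (S f h vp) (min s vp)) (Icc a b) :=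
      (continuousOn_unitSlopeFlux hf hh).comp (by fun_prop) fun s hs =>
        ⟨le_min (hsub hs).1.le hvp.1, (min_le_left _ _).trans (hsub hs).2.le⟩
    fun_prop
  · rintro s ⟨hs, hne⟩
    have hs' := hsub (Ioo_subset_Icc_self hs)
    have hfs := hf.pos s hs'
    have h1 := ((hasDerivAt_id s).const_mul (S f h vp)).add (hh.hasDerivAt hs')
    rcases lt_or_gt_of_ne (show s ≠ vp from hne) with hlt | hgt
    · have h2 : HasDerivAt (fun s => unitSlopeFlux f h (S f h vp) (min s vp))
          (S f h vp + dI h s - f s) s := by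
        refine (hasDerivAt_unitSlopeFlux hf hh hs').congr_of_eventuallyEq ?_
        filter_upwards [gt_mem_nhds hlt] with t ht'
        rw [min_eq_left ht'.le]
      refine (h1.sub h2).congr_deriv ?_
      rw [limitInvSlope_of_ge hlt.le]
      ring
    · have h2 : HasDerivAt (fun s => unitSlopeFlux f h (S f h vp) (min s vp)) 0 s := by
        refine (hasDerivAt_const s (unitSlopeFlux f h (S f h vp) vp)).congr_of_eventuallyEq ?_
        filter_upwards [lt_mem_nhds hgt] with t ht'
        rw [min_eq_right ht'.le]
      refine (h1.sub h2).congr_deriv ?_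
      rw [ht.limitInvSlope_of_le hf hh hs' hgt.le]
      field_simp
      ring
  · refine ContinuousOn.intervalIntegrable ?_
    rw [uIcc_of_le hab]
    exact (hf.continuousOn.mono (hsub.trans Ioo_subset_Icc_self)).mul
      ((ht.continuousOn_limitInvSlope hf hh).mono hsub)

/-- Travel times converge: by the flux equation, convergence of the fluxes is convergence of the
distribution functions of the densities `f / v'`, and the travel time is the integral of `1 / f`
against this density. -/
theorem IsTransition.tendsto_travelTime (hf : ReactionF f) (hh : ConvectionH h)
    (ht : IsTransition f h vp) {W : ℝ → ℝ → ℝ}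
    (hW : ∀ ε > 0, IsFlux f h ε (criticalSpeed f h ε) (W ε) ∧ W ε 0 = 0)
    (hv : v ∈ Ioo (0 : ℝ) 1) :
    Tendsto (fun ε => travelTime (fun s => invSlope ε (W ε s)) v) (𝓝[>] 0)
      (𝓝 (travelTime (limitInvSlope f h vp) v)) := by
  have key : ∀ a b : ℝ, 0 < a → a ≤ b → b < 1 →
      Tendsto (fun ε => ∫ s in a..b, invSlope ε (W ε s)) (𝓝[>] 0)
        (𝓝 (∫ s in a..b, limitInvSlope f h vp s)) := by
    intro a b ha hab hb
    have hsub : Icc a b ⊆ Ioo (0 : ℝ) 1 := fun x hx => ⟨ha.trans_le hx.1, hx.2.trans_lt hb⟩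
    have hfc : ContinuousOn f (Icc a b) := hf.continuousOn.mono (hsub.trans Ioo_subset_Icc_self)
    have hcancel : ∀ r : ℝ → ℝ, ∫ s in a..b, (f s)⁻¹ * (f s * r s) = ∫ s in a..b, r s := by
      refine fun r => intervalIntegral.integral_congr fun s hs => ?_
      rw [uIcc_of_le hab] at hs
      exact inv_mul_cancel_left₀ (hf.pos s (hsub hs)).ne' _
    have h1 := tendsto_integral_mul_of_tendsto_integral (l := 𝓝[>] (0 : ℝ)) hab
      (ρ := fun ε s => f s * invSlope ε (W ε s)) (ρ₀ := fun s => f s * limitInvSlope f h vp s)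
      (ψ := fun s => (f s)⁻¹) ?_ (hfc.mul ((ht.continuousOn_limitInvSlope hf hh).mono hsub)) ?_ ?_
      (hfc.inv₀ fun s hs => (hf.pos s (hsub hs)).ne')
    · simpa only [hcancel] using h1
    · filter_upwards [self_mem_nhdsWithin] with ε hε
      exact ⟨hfc.mul ((hW ε hε).1.continuousOn_invSlope.mono hsub), fun s hs =>
        mul_nonneg (hf.pos s (hsub hs)).le (invSlope_pos ((hW ε hε).1.pos s (hsub hs))).le⟩
    · exact fun s hs => mul_nonneg (hf.pos s (hsub hs)).le
        (zero_le_one.trans (ht.one_le_limitInvSlope hf hh (hsub hs)))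
    · intro x hx
      have hx1 : x < 1 := (hsub hx).2
      rw [ht.integral_mul_limitInvSlope hf hh ha hx.1 hx1]
      have hcs := tendsto_criticalSpeed hf hh ht.mem ht.S_le
      have h2 : ∀ y ∈ Ioo (0 : ℝ) 1, Tendsto (fun ε => criticalSpeed f h ε * y + h y - W ε y)
          (𝓝[>] 0) (𝓝 (S f h vp * y + h y - unitSlopeFlux f h (S f h vp) (min y vp))) :=
        fun y hy => ((hcs.mul_const y).add_const (h y)).sub (ht.tendsto_flux hf hh hW hy)
      refine ((h2 x (hsub hx)).sub (h2 a (hsub ⟨le_rfl, hab⟩))).congr' ?_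
      filter_upwards [self_mem_nhdsWithin] with ε hε
      exact ((hW ε hε).1.integral_mul_invSlope hf hh ha hx.1 hx1).symm
  unfold travelTime
  rcases le_total (1 / 2) v with hle | hle
  · exact key _ _ (by norm_num) hle hv.2
  · simp only [intervalIntegral.integral_symm v (1 / 2)]
    exact (key _ _ hv.1 hle (by norm_num)).neg

theorem IsTransition.tendstoUniformly (hf : ReactionF f) (hh : ConvectionH h)
    (ht : IsTransition f h vp) :
    TendstoUniformly (criticalProfile f h) (heightAt (travelTime (limitInvSlope f h vp)))
      (𝓝[>] 0) := by
  have : ∀ ε : ℝ, ∃ w, ε > 0 → IsFlux f h ε (criticalSpeed f h ε) w ∧ w 0 = 0 := fun ε => by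
    by_cases hε : 0 < ε
    · obtain ⟨w, hw⟩ := (isAdmissible_iff hε hf hh).1 (isLeast_criticalSpeed hf hh hε).1
      exact ⟨w, fun _ => hw⟩
    · exact ⟨0, fun h => absurd h hε⟩
  choose W hW using this
  refine (ht.isTravelTime hf hh).tendstoUniformly_heightAt
    (Tn := fun ε => travelTime fun s => invSlope ε (W ε s)) ?_
    fun v hv => ht.tendsto_travelTime hf hh hW hv
  filter_upwards [self_mem_nhdsWithin] with ε hε
  have hu := isFrontProfile_criticalProfile hf hh hε
  exact ⟨(hW ε hε).1.isTravelTime.strictMonoOn, fun z =>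
    ⟨hu.mem_Ioo z, hu.travelTime_eq hf hε (hW ε hε).1 z⟩⟩

end limit

/-! ### The inviscid profile -/

section inviscid

variable {f h V W : ℝ → ℝ} {c z₀ v₀ : ℝ} {J J' : Set ℝ}

theorem IsInviscidSolution.hasDerivWithinAt (hV : IsInviscidSolution f h c z₀ v₀ J V) {z : ℝ}
    (hz : z ∈ J) : HasDerivWithinAt V (derivWithin V J z) J z :=
  (hV.contDiffOn.differentiableOn one_ne_zero z hz).hasDerivWithinAt

/-- An inviscid solution which takes its values in `(0,1)`, where `f > 0`, and along which
`c + h' > 0`, is the only one: near such heights the equation says that the increasing function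
`∫ (c + h') / f` grows with rate `1` along solutions, so that agreement is an open condition. -/
theorem IsInviscidSolution.eqOn (hf : ReactionF f) (hh : ConvectionH h)
    (hV : IsInviscidSolution f h c z₀ v₀ J V) (hW : IsInviscidSolution f h c z₀ v₀ J' W)
    (hmem : ∀ z ∈ J, V z ∈ Ioo (0 : ℝ) 1) (hpos : ∀ z ∈ J, 0 < c + dI h (V z)) :
    EqOn W V (J ∩ J') := by
  have hord : (J ∩ J').OrdConnected := hV.ordConnected.inter hW.ordConnected
  have hVd : ∀ z ∈ J ∩ J', HasDerivWithinAt V (derivWithin V J z) (J ∩ J') z := fun z hz =>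
    (hV.hasDerivWithinAt hz.1).mono inter_subset_left
  have hWd : ∀ z ∈ J ∩ J', HasDerivWithinAt W (derivWithin W J' z) (J ∩ J') z := fun z hz =>
    (hW.hasDerivWithinAt hz.2).mono inter_subset_right
  set g : ℝ → ℝ := fun v => (c + dI h v) / f v with hg
  have hgc : ContinuousOn g (Ioo 0 1) := continuousOn_add_div hf hh c
  have hopen : ∀ x ∈ J ∩ J', W x = V x → ∀ᶠ y in 𝓝[J ∩ J'] x, W y = V y := by
    intro x hx hWV
    have hN : {v | v ∈ Ioo (0 : ℝ) 1 ∧ 0 < c + dI h v} ∈ 𝓝 (V x) := by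
      have h1 := Ioo_mem_nhds (hmem x hx.1).1 (hmem x hx.1).2
      have h2 : ContinuousAt (fun v => c + dI h v) (V x) :=
        (continuousOn_const.add hh.continuousOn_dI).continuousAt
          (Icc_mem_nhds (hmem x hx.1).1 (hmem x hx.1).2)
      filter_upwards [h1, h2.eventually (lt_mem_nhds (hpos x hx.1))] with v hv hv' using ⟨hv, hv'⟩
    obtain ⟨δ, hδ, hball⟩ := Metric.mem_nhds_iff.1 hN
    have hmono : StrictMonoOn (travelTime g) (Metric.ball (V x) δ) := by
      refine strictMonoOn_of_deriv_pos (convex_ball _ _) (fun v hv =>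
        (hasDerivAt_travelTime hgc (hball hv).1).continuousAt.continuousWithinAt) fun v hv => ?_
      have hv' := hball (interior_subset hv)
      rw [(hasDerivAt_travelTime hgc hv'.1).deriv]
      exact div_pos hv'.2 (hf.pos v hv'.1)
    have hev : ∀ᶠ y in 𝓝[J ∩ J'] x, V y ∈ Metric.ball (V x) δ ∧ W y ∈ Metric.ball (V x) δ := by
      refine ((hVd x hx).continuousWithinAt.eventually_mem (Metric.ball_mem_nhds _ hδ)).and
        ((hWd x hx).continuousWithinAt.eventually_mem ?_)
      rw [hWV]; exact Metric.ball_mem_nhds _ hδ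
    obtain ⟨r, hr, hball'⟩ := Metric.mem_nhdsWithin_iff.1 hev
    set I := Metric.ball x r ∩ (J ∩ J') with hI
    have hIc : Convex ℝ I := (convex_ball x r).inter hord.convex
    have hH : ∀ y ∈ I, HasDerivWithinAt (fun y => travelTime g (W y) - travelTime g (V y)) 0 I y := by
      intro y hy
      obtain ⟨hVy, hWy⟩ := hball' hy
      have h1 := ((hasDerivAt_travelTime hgc (hball hWy).1).comp_hasDerivWithinAt y
        ((hWd y hy.2).mono (inter_subset_right : I ⊆ J ∩ J'))).sub
        ((hasDerivAt_travelTime hgc (hball hVy).1).comp_hasDerivWithinAt y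
        ((hVd y hy.2).mono (inter_subset_right : I ⊆ J ∩ J')))
      refine h1.congr_deriv ?_
      have h2 := (hf.pos _ (hball hWy).1).ne'
      have h3 := (hf.pos _ (hball hVy).1).ne'
      simp only [hg]
      rw [div_mul_eq_mul_div, div_mul_eq_mul_div, hW.equation y hy.2.2, hV.equation y hy.2.1,
        div_self h2, div_self h3, sub_self]
    refine Metric.mem_nhdsWithin_iff.2 ⟨r, hr, fun y hy => ?_⟩
    obtain ⟨hVy, hWy⟩ := hball' hy
    have h1 := hIc.norm_image_sub_le_of_norm_hasDerivWithin_le (C := 0) hH (by simp)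
      ⟨Metric.mem_ball_self hr, hx⟩ hy
    rw [zero_mul, norm_le_zero_iff, hWV, sub_self, sub_zero] at h1
    exact hmono.injOn hWy hVy (sub_eq_zero.1 h1)
  intro z hz
  refine IsPreconnected.induction₂' (s := J ∩ J') hord.isPreconnected
    (fun x y => W x = V x → W y = V y) (fun x hx => ?_)
    (fun x y z _ _ _ hxy hyz h => hyz (hxy h)) ⟨hV.mem, hW.mem⟩ hz (by rw [hV.initial, hW.initial])
  by_cases hWV : W x = V x
  · filter_upwards [hopen x hx hWV] with y hy using ⟨fun _ => hy, fun _ => hWV⟩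
  · have h1 := (hWd x hx).continuousWithinAt.sub (hVd x hx).continuousWithinAt
    filter_upwards [h1.eventually_ne (sub_ne_zero.2 hWV)] with y hy
    exact ⟨fun h => absurd h hWV, fun h => absurd (sub_eq_zero.2 h) hy⟩

/-- An inviscid solution crosses a height at which `c + h' = f > 0` with slope `1`, hence upwards,
hence at most once. -/
theorem IsInviscidSolution.eq_of_apply_eq (hW : IsInviscidSolution f h c z₀ v₀ J W) {v : ℝ}
    (hfv : 0 < f v) (hv : c + dI h v = f v) {x y : ℝ} (hx : x ∈ J) (hy : y ∈ J) (hWx : W x = v)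
    (hWy : W y = v) : x = y := by
  have hslope : ∀ z ∈ J, W z = v → derivWithin W J z = 1 := fun z hz hWz => by
    have := hW.equation z hz
    rw [hWz, hv] at this
    exact mul_left_cancel₀ hfv.ne' (this.trans (mul_one _).symm)
  have key : ∀ x y, x ∈ J → y ∈ J → W x = v → W y = v → x < y → False := by
    intro x y hx hy hWx hWy hxy
    have hsub : Icc x y ⊆ J := hW.ordConnected.out hx hy
    have hge : ∀ ⦃t⦄, t ∈ Icc x y → v ≤ W t := by
      refine image_le_of_deriv_right_lt_deriv_boundary' (f := fun _ => v) (f' := fun _ => 0)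
        (B' := fun t => derivWithin W J t) continuousOn_const
        (fun t _ => hasDerivWithinAt_const t _ v) hWx.ge
        (fun t ht => ((hW.hasDerivWithinAt (hsub ht)).mono hsub).continuousWithinAt)
        (fun t ht => ?_) (fun t ht hvt => ?_)
      · have h1 := (hW.hasDerivWithinAt (hsub (Ico_subset_Icc_self ht))).mono hsub
        exact (h1.mono (Icc_subset_Icc_left ht.1)).mono_of_mem_nhdsWithin
          (Icc_mem_nhdsGE ht.2)
      · rw [hslope t (hsub (Ico_subset_Icc_self ht)) hvt.symm]
        exact one_pos
    have hd := ((hW.hasDerivWithinAt hy).mono hsub)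
    rw [hslope y hy hWy, hasDerivWithinAt_iff_tendsto_slope, Icc_sdiff_right,
      nhdsWithin_Ico_eq_nhdsLT hxy] at hd
    have hle : (1 : ℝ) ≤ 0 := by
      refine le_of_tendsto hd ?_
      filter_upwards [Ioo_mem_nhdsLT hxy] with t ht
      rw [slope_def_field, hWy]
      exact div_nonpos_of_nonneg_of_nonpos (sub_nonneg.2 (hge (Ioo_subset_Icc_self ht)))
        (sub_nonpos.2 ht.2.le)
    exact absurd hle (by norm_num)
  rcases lt_trichotomy x y with hlt | heq | hgt
  · exact (key x y hx hy hWx hWy hlt).elim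
  · exact heq
  · exact (key y x hy hx hWy hWx hgt).elim

end inviscid

/-! ### The limit front -/

section front

variable {f h : ℝ → ℝ} {vp v z : ℝ}

/-- The limit front with transition at the height `vp`, which is the uniform limit of the critical
profiles. -/
noncomputable def limitFront (f h : ℝ → ℝ) (vp : ℝ) : ℝ → ℝ :=
  heightAt (travelTime (limitInvSlope f h vp))

theorem travelTime_limitInvSlope (hf : ReactionF f) (hh : ConvectionH h)
    (ht : IsTransition f h vp) {a b : ℝ} (ha : a ∈ Ioo (0 : ℝ) 1) (hb : b ∈ Ioo (0 : ℝ) 1)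
    (hav : a ≤ vp) (hbv : b ≤ vp) :
    travelTime (limitInvSlope f h vp) b - travelTime (limitInvSlope f h vp) a = b - a := by
  have hc := ht.continuousOn_limitInvSlope hf hh
  unfold travelTime
  rw [intervalIntegral.integral_interval_sub_left
    (hc.mono (uIcc_half_subset hb)).intervalIntegrable
    (hc.mono (uIcc_half_subset ha)).intervalIntegrable,
    intervalIntegral.integral_congr (g := fun _ => 1), integral_one]
  intro s hs
  exact limitInvSlope_of_ge (hs.2.trans (max_le hav hbv))

/-- Below the transition the limit front is a line of slope `1`, truncated at `0`. -/
theorem IsTransition.limitFront_eq_linearProfile (hf : ReactionF f) (hh : ConvectionH h)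
    (ht : IsTransition f h vp) (hvp : vp ∈ Ioo (0 : ℝ) 1)
    (hz : z ≤ travelTime (limitInvSlope f h vp) vp) :
    limitFront f h vp z = linearProfile (travelTime (limitInvSlope f h vp) vp) vp z := by
  set T := travelTime (limitInvSlope f h vp) with hT
  have hTT : IsTravelTime T := ht.isTravelTime hf hh
  set x := z - T vp + vp with hx
  have hxv : x ≤ vp := by linarith
  unfold linearProfile
  rw [min_eq_right (hxv.trans hvp.2.le)]
  rcases lt_or_ge 0 x with hx0 | hx0
  · have hxI : x ∈ Ioo (0 : ℝ) 1 := ⟨hx0, hxv.trans_lt hvp.2⟩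
    rw [max_eq_right hx0.le]
    refine hTT.heightAt_eq hxI ?_
    have := travelTime_limitInvSlope hf hh ht hxI hvp hxv le_rfl
    linarith
  · rw [max_eq_left hx0]
    refine le_antisymm ?_ heightAt_mem_Icc.1
    by_contra! hpos
    obtain ⟨a, ha0, ha⟩ := exists_between (lt_min hpos hvp.1)
    have haI : a ∈ Ioo (0 : ℝ) 1 := ⟨ha0, (ha.trans_le (min_le_right _ _)).trans hvp.2⟩
    have h1 := hTT.lt_of_lt_heightAt haI (ha.trans_le (min_le_left _ _))
    have h2 := travelTime_limitInvSlope hf hh ht haI hvp (ha.trans_le (min_le_right _ _)).le le_rfl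
    linarith

theorem IsTransition.limitFront_one (hf : ReactionF f) (hh : ConvectionH h)
    (ht : IsTransition f h 1) : limitFront f h 1 = linearProfile 0 (1 / 2) := by
  set T := travelTime (limitInvSlope f h 1) with hT
  have hTT : IsTravelTime T := ht.isTravelTime hf hh
  have hTv : ∀ v ∈ Ioo (0 : ℝ) 1, T v = v - 1 / 2 := fun v hv => by
    have := travelTime_limitInvSlope hf hh ht (a := 1 / 2) (by norm_num) hv (by norm_num) hv.2.le
    rwa [travelTime_half, sub_zero] at this
  funext z
  have hmem := heightAt_mem_Icc (T := T) (z := z)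
  change heightAt T z = max 0 (min 1 (z - 0 + 1 / 2))
  rcases le_or_gt (z - 0 + 1 / 2) 0 with h0 | h0
  · rw [max_eq_left ((min_le_right _ _).trans h0)]
    refine le_antisymm ?_ hmem.1
    by_contra! hpos
    obtain ⟨a, ha0, ha⟩ := exists_between hpos
    have haI : a ∈ Ioo (0 : ℝ) 1 := ⟨ha0, ha.trans_le hmem.2⟩
    have := hTT.lt_of_lt_heightAt haI ha
    rw [hTv a haI] at this
    linarith
  rcases le_or_gt 1 (z - 0 + 1 / 2) with h1 | h1
  · rw [min_eq_left h1, max_eq_right zero_le_one]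
    refine le_antisymm hmem.2 ?_
    by_contra! hlt
    obtain ⟨a, ha, ha1⟩ := exists_between hlt
    have haI : a ∈ Ioo (0 : ℝ) 1 := ⟨hmem.1.trans_lt ha, ha1⟩
    have := lt_of_heightAt_lt haI ha
    rw [hTv a haI] at this
    linarith
  · rw [min_eq_right h1.le, max_eq_right h0.le]
    refine hTT.heightAt_eq ⟨h0, h1⟩ ?_
    rw [hTv _ ⟨h0, h1⟩]
    ring

theorem IsTransition.limitFront_lt_one (hf : ReactionF f) (hh : ConvectionH h)
    (ht : IsTransition f h vp) (hvp : vp < 1) (z : ℝ) : limitFront f h vp z < 1 := by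
  obtain ⟨a, hva, ha1⟩ := exists_between hvp
  have haI : a ∈ Ioo (0 : ℝ) 1 := ⟨ht.mem.1.trans_lt hva, ha1⟩
  have hsub : Icc a 1 ⊆ Icc 0 1 := Icc_subset_Icc_left haI.1.le
  obtain ⟨k, hk0, hk⟩ := hf.bound
  obtain ⟨m, hm, hmin⟩ := isCompact_Icc.exists_isMinOn (nonempty_Icc.2 ha1.le)
    ((continuousOn_const.add hh.continuousOn_dI : ContinuousOn (fun v => S f h vp + dI h v) _).mono
      hsub)
  have hm0 : 0 < S f h vp + dI h m := by
    have := ht.lt m ⟨hva.trans_le hm.1, hm.2⟩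
    linarith [hf.nonneg (hsub hm)]
  refine (ht.isTravelTime hf hh).heightAt_lt_one (exists_lt_travelTime
    (ht.continuousOn_limitInvSlope hf hh) haI (div_pos hm0 hk0) (fun s hs => ?_) z)
  have hsI : s ∈ Ioo (0 : ℝ) 1 := ⟨haI.1.trans hs.1, hs.2⟩
  rw [ht.limitInvSlope_of_le hf hh hsI (hva.trans hs.1).le, div_div]
  have h1 : S f h vp + dI h m ≤ S f h vp + dI h s := hmin (Ioo_subset_Icc_self hs)
  have h2 := (hk s (Ioo_subset_Icc_self hsI)).2
  have h3 := hf.pos s hsI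
  have h4 : 0 ≤ S f h vp + dI h s := hm0.le.trans h1
  gcongr

theorem IsTransition.hasDerivAt_limitFront (hf : ReactionF f) (hh : ConvectionH h)
    (ht : IsTransition f h vp) (hz : limitFront f h vp z ∈ Ioo (0 : ℝ) 1) :
    HasDerivAt (limitFront f h vp) (limitInvSlope f h vp (limitFront f h vp z))⁻¹ z :=
  (ht.isTravelTime hf hh).hasDerivAt_heightAt hz
    (hasDerivAt_travelTime (ht.continuousOn_limitInvSlope hf hh) hz)
    (zero_lt_one.trans_le (ht.one_le_limitInvSlope hf hh hz)).ne'

theorem IsTransition.continuous_limitFront (hf : ReactionF f) (hh : ConvectionH h)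
    (ht : IsTransition f h vp) : Continuous (limitFront f h vp) :=
  (ht.isTravelTime hf hh).continuous_heightAt

theorem IsTransition.isOpen_limitFront_pos (hf : ReactionF f) (hh : ConvectionH h)
    (ht : IsTransition f h vp) : IsOpen {z | 0 < limitFront f h vp z} :=
  isOpen_lt continuous_const (ht.continuous_limitFront hf hh)

theorem IsTransition.contDiffOn_limitFront (hf : ReactionF f) (hh : ConvectionH h)
    (ht : IsTransition f h vp) (hvp : vp < 1) :
    ContDiffOn ℝ 1 (limitFront f h vp) {z | 0 < limitFront f h vp z} := by
  have hmem : ∀ z, 0 < limitFront f h vp z → limitFront f h vp z ∈ Ioo (0 : ℝ) 1 := fun z hz =>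
    ⟨hz, ht.limitFront_lt_one hf hh hvp z⟩
  rw [show (1 : WithTop ℕ∞) = 0 + 1 by norm_num,
    contDiffOn_succ_iff_deriv_of_isOpen (ht.isOpen_limitFront_pos hf hh)]
  refine ⟨fun z hz => (ht.hasDerivAt_limitFront hf hh
    (hmem z hz)).differentiableAt.differentiableWithinAt, by simp, contDiffOn_zero.2 ?_⟩
  have h1 : ContinuousOn (fun z => (limitInvSlope f h vp (limitFront f h vp z))⁻¹)
      {z | 0 < limitFront f h vp z} :=
    ((ht.continuousOn_limitInvSlope hf hh).comp (ht.continuous_limitFront hf hh).continuousOn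
      hmem).inv₀ fun z hz =>
      (zero_lt_one.trans_le (ht.one_le_limitInvSlope hf hh (hmem z hz))).ne'
  exact h1.congr fun z hz => (ht.hasDerivAt_limitFront hf hh (hmem z hz)).deriv

theorem limitFront_zero (hf : ReactionF f) (hh : ConvectionH h)
    (ht : IsTransition f h vp) : limitFront f h vp 0 = 1 / 2 :=
  (ht.isTravelTime hf hh).heightAt_eq (by norm_num) travelTime_half

/-- Above the transition the limit front is the inviscid profile. -/
theorem IsTransition.isInviscidProfile (hf : ReactionF f) (hh : ConvectionH h)
    (ht : IsTransition f h vp) (hvp : vp < 1) {J : Set ℝ} (hJ : J.OrdConnected)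
    (hJ' : (interior J).Nonempty)
    (hpos : ∀ z ∈ J, 0 < limitFront f h vp z) (hge : ∀ z ∈ J, vp ≤ limitFront f h vp z)
    {z₀ : ℝ} (hz₀ : z₀ ∈ J) :
    IsInviscidProfile f h (S f h vp) z₀ (limitFront f h vp z₀) J (limitFront f h vp) := by
  have hmem : ∀ z ∈ J, limitFront f h vp z ∈ Ioo (0 : ℝ) 1 := fun z hz =>
    ⟨hpos z hz, ht.limitFront_lt_one hf hh hvp z⟩
  have hadd : ∀ z ∈ J, 0 < S f h vp + dI h (limitFront f h vp z) := fun z hz =>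
    (hf.pos _ (hmem z hz)).trans_le (ht.le_add hf hh (hmem z hz) (hge z hz))
  have hunique : UniqueDiffOn ℝ J := uniqueDiffOn_convex hJ.convex hJ'
  have hsol : IsInviscidSolution f h (S f h vp) z₀ (limitFront f h vp z₀) J (limitFront f h vp) := by
    refine ⟨hJ, ?_, hz₀, hadd z₀ hz₀, rfl, fun z hz => Ioo_subset_Icc_self (hmem z hz),
      (ht.contDiffOn_limitFront hf hh hvp).mono hpos, fun z hz => ?_⟩
    · obtain ⟨a, ha⟩ := hJ'
      exact (infinite_of_mem_nhds a (mem_interior_iff_mem_nhds.1 ha)).nontrivial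
    · rw [(ht.hasDerivAt_limitFront hf hh (hmem z hz)).hasDerivWithinAt.derivWithin (hunique z hz),
        ht.limitInvSlope_of_le hf hh (hmem z hz) (hge z hz), inv_div,
        mul_div_cancel₀ _ (hadd z hz).ne']
  exact ⟨hsol, fun J' W hW => hsol.eqOn hf hh hW hmem hadd⟩

end front

/-! ### The position of the transition -/

section transition

variable {f h r : ℝ → ℝ} {vp m v a b κ : ℝ}

theorem hasDerivAt_S (hf : ReactionF f) (hh : ConvectionH h) (hv : v ∈ Ioo (0 : ℝ) 1) :
    HasDerivAt (S f h) (dI (S f h) v) v := by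
  have hv' := Ioo_subset_Ioc_self hv
  rw [dI_S hf hh hv']
  exact (hasDerivWithinAt_S hf hh hv').hasDerivAt (Icc_mem_nhds hv.1 hv.2)

theorem isTransition_zero (hf : ReactionF f) (hh : ConvectionH h)
    (hS : ∀ v ∈ Ioc (0 : ℝ) 1, dI (S f h) v < 0) : IsTransition f h 0 := by
  have hm := monotoneOn_of_hasDerivAt_nonneg (g := fun v => -S f h v) (convex_Icc (0 : ℝ) 1)
    (continuousOn_S hf hh).neg (by rw [interior_Icc]; exact fun v hv => (hasDerivAt_S hf hh hv).neg)
    (by rw [interior_Icc]; exact fun v hv => neg_nonneg.2 (hS v (Ioo_subset_Ioc_self hv)).le)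
  have hle : ∀ v ∈ Ioc (0 : ℝ) 1, S f h v ≤ S f h 0 := fun v hv =>
    neg_le_neg_iff.1 (hm (left_mem_Icc.2 zero_le_one) (Ioc_subset_Icc_self hv) hv.1.le)
  refine ⟨left_mem_Icc.2 zero_le_one, hle, fun v hv => ?_⟩
  have h1 := hS v hv
  rw [dI_S hf hh hv] at h1
  have h2 : f v - dI h v - S f h v < 0 := by
    by_contra! h3
    exact h1.not_ge (div_nonneg h3 hv.1.le)
  linarith [hle v hv]

theorem isTransition_one (hf : ReactionF f) (hh : ConvectionH h)
    (hS : ∀ v ∈ Ioo (0 : ℝ) 1, 0 < dI (S f h) v) : IsTransition f h 1 := by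
  have hm := monotoneOn_of_hasDerivAt_nonneg (convex_Icc (0 : ℝ) 1)
    (continuousOn_S hf hh) (by rw [interior_Icc]; exact fun v hv => hasDerivAt_S hf hh hv)
    (by rw [interior_Icc]; exact fun v hv => (hS v hv).le)
  exact ⟨right_mem_Icc.2 zero_le_one,
    fun v hv => hm (Ioc_subset_Icc_self hv) (right_mem_Icc.2 zero_le_one) hv.2,
    fun v hv => absurd hv.2 hv.1.not_ge⟩

/-- The largest maximum point of `S`, if its maximum is positive and not attained at `1`. -/
theorem exists_isGreatest_argmax (hf : ReactionF f) (hh : ConvectionH h) (h0 : 0 < supS f h)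
    (h1 : supS f h ≠ S f h 1) :
    ∃ vp ∈ Ioo (0 : ℝ) 1, S f h vp = supS f h ∧ (∀ v ∈ Ioc (0 : ℝ) 1, S f h v ≤ S f h vp) ∧
      ∀ v ∈ Icc (0 : ℝ) 1, S f h v = supS f h → v ≤ vp := by
  have hc := continuousOn_S hf hh
  have hbdd : BddAbove (S f h '' Ioc 0 1) :=
    (isCompact_Icc.bddAbove_image hc).mono (image_mono Ioc_subset_Icc_self)
  have hle : ∀ v ∈ Ioc (0 : ℝ) 1, S f h v ≤ supS f h := fun v hv =>
    le_csSup hbdd (mem_image_of_mem _ hv)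
  have hle' : ∀ v ∈ Icc (0 : ℝ) 1, S f h v ≤ supS f h := fun v hv => by
    rcases hv.1.eq_or_lt with rfl | hv0
    · rw [S_zero]; exact h0.le
    · exact hle v ⟨hv0, hv.2⟩
  obtain ⟨m, hm, hmax⟩ := isCompact_Icc.exists_isMaxOn (nonempty_Icc.2 zero_le_one) hc
  have hne : (Icc (0 : ℝ) 1 ∩ S f h ⁻¹' {supS f h}).Nonempty := by
    refine ⟨m, hm, le_antisymm (hle' m hm) (csSup_le ?_ ?_)⟩
    · exact (nonempty_Ioc.2 zero_lt_one).image _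
    · rintro _ ⟨v, hv, rfl⟩
      exact hmax (Ioc_subset_Icc_self hv)
  have hcomp : IsCompact (Icc (0 : ℝ) 1 ∩ S f h ⁻¹' {supS f h}) :=
    isCompact_Icc.of_isClosed_subset (hc.preimage_isClosed_of_isClosed isClosed_Icc
      isClosed_singleton) inter_subset_left
  obtain ⟨vp, ⟨hvp, hvpS⟩, hgr⟩ := hcomp.exists_isGreatest hne
  have hvpS : S f h vp = supS f h := hvpS
  refine ⟨vp, ⟨hvp.1.lt_of_ne ?_, hvp.2.lt_of_ne ?_⟩, hvpS, fun v hv => hvpS ▸ hle v hv,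
    fun v hv hvS => hgr ⟨hv, hvS⟩⟩
  · rintro rfl
    rw [S_zero] at hvpS
    exact h0.ne hvpS
  · rintro rfl
    exact h1 hvpS.symm

theorem mem_tangencyPoints_of_isMax (hf : ReactionF f) (hh : ConvectionH h)
    (hvp : vp ∈ Ioo (0 : ℝ) 1) (hS : ∀ v ∈ Ioc (0 : ℝ) 1, S f h v ≤ S f h vp) :
    vp ∈ tangencyPoints f h := by
  refine ⟨Ioo_subset_Ioc_self hvp, ?_⟩
  rw [← S_eq_of_isMax hf hh hvp hS, S, mul_div_cancel₀ _ hvp.1.ne']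

/-- A continuous function on `[0,1]` with only one local maximum point `m` increases strictly up to
`m` and decreases strictly from there: otherwise the maximum over `[0,b]` for some `b ≤ m`, or over
`[a,1]` for some `a ≥ m`, would be another local maximum. -/
theorem HasUniqueMaximumPoint.exists_strictMonoOn (hr : ContinuousOn r (Icc 0 1))
    (hu : HasUniqueMaximumPoint r) :
    ∃ m ∈ Icc (0 : ℝ) 1, StrictMonoOn r (Icc 0 m) ∧ StrictAntiOn r (Icc m 1) := by
  obtain ⟨m, ⟨hm, -⟩, huniq⟩ := hu
  refine ⟨m, hm, fun a ha b hb hab => ?_, fun a ha b hb hab => ?_⟩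
  · by_contra! hle
    have hb1 : b ≤ 1 := hb.2.trans hm.2
    obtain ⟨x, hx, hmax⟩ := isCompact_Icc.exists_isMaxOn (nonempty_Icc.2 hb.1)
      (hr.mono (Icc_subset_Icc_right hb1))
    obtain ⟨y, hy0, hyb, hy⟩ : ∃ y, 0 ≤ y ∧ y < b ∧ ∀ t ∈ Icc 0 b, r t ≤ r y := by
      rcases hx.2.eq_or_lt with rfl | hxb
      · exact ⟨a, ha.1, hab, fun t ht => (hmax ht).trans hle⟩
      · exact ⟨x, hx.1, hxb, fun t ht => hmax ht⟩
    have hloc : IsLocalMaxOn r (Icc 0 1) y := by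
      filter_upwards [self_mem_nhdsWithin, mem_nhdsWithin_of_mem_nhds (gt_mem_nhds hyb)]
        with t ht htb using hy t ⟨ht.1, htb.le⟩
    have := huniq y ⟨⟨hy0, hyb.le.trans hb1⟩, hloc⟩
    linarith [hb.2]
  · by_contra! hle
    have ha0 : 0 ≤ a := hm.1.trans ha.1
    obtain ⟨x, hx, hmax⟩ := isCompact_Icc.exists_isMaxOn (nonempty_Icc.2 ha.2)
      (hr.mono (Icc_subset_Icc_left ha0))
    obtain ⟨y, hy1, hay, hy⟩ : ∃ y, y ≤ 1 ∧ a < y ∧ ∀ t ∈ Icc a 1, r t ≤ r y := by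
      rcases hx.1.eq_or_lt with rfl | hax
      · exact ⟨b, hb.2, hab, fun t ht => (hmax ht).trans hle⟩
      · exact ⟨x, hx.2, hax, fun t ht => hmax ht⟩
    have hloc : IsLocalMaxOn r (Icc 0 1) y := by
      filter_upwards [self_mem_nhdsWithin, mem_nhdsWithin_of_mem_nhds (lt_mem_nhds hay)]
        with t ht htb using hy t ⟨htb.le, ht.2⟩
    have := huniq y ⟨⟨ha0.trans hay.le, hy1⟩, hloc⟩
    linarith [ha.1]

theorem unitSlopeFlux_strictMonoOn (hf : ReactionF f) (hh : ConvectionH h) (ha : 0 ≤ a) (hb : b ≤ 1)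
    (hlt : ∀ s ∈ Ioo a b, f s - dI h s < κ) : StrictMonoOn (unitSlopeFlux f h κ) (Icc a b) := by
  refine strictMonoOn_of_deriv_pos (convex_Icc a b)
    ((continuousOn_unitSlopeFlux hf hh).mono (Icc_subset_Icc ha hb)) ?_
  rw [interior_Icc]
  intro s hs
  rw [(hasDerivAt_unitSlopeFlux hf hh ⟨ha.trans_lt hs.1, hs.2.trans_le hb⟩).deriv]
  linarith [hlt s hs]

theorem unitSlopeFlux_strictAntiOn (hf : ReactionF f) (hh : ConvectionH h) (ha : 0 ≤ a) (hb : b ≤ 1)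
    (hlt : ∀ s ∈ Ioo a b, κ < f s - dI h s) : StrictAntiOn (unitSlopeFlux f h κ) (Icc a b) := by
  refine strictAntiOn_of_deriv_neg (convex_Icc a b)
    ((continuousOn_unitSlopeFlux hf hh).mono (Icc_subset_Icc ha hb)) ?_
  rw [interior_Icc]
  intro s hs
  rw [(hasDerivAt_unitSlopeFlux hf hh ⟨ha.trans_lt hs.1, hs.2.trans_le hb⟩).deriv]
  linarith [hlt s hs]

/-- With `r = f - h'`, the tangency points are the zeros of `v r(v) - ∫₀ᵛ r`. This function is
positive where `r` increases and strictly decreasing where `r` decreases, hence there is at most one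
tangency point, and it lies beyond the maximum point of `r`. -/
theorem tangencyPoints_of_unimodal (hf : ReactionF f) (hh : ConvectionH h)
    (hmono : StrictMonoOn (fun v => f v - dI h v) (Icc 0 m))
    (hanti : StrictAntiOn (fun v => f v - dI h v) (Icc m 1)) :
    (∀ v ∈ tangencyPoints f h, m < v) ∧ (tangencyPoints f h).Subsingleton := by
  have hbeyond : ∀ v ∈ tangencyPoints f h, m < v := by
    rintro v ⟨hv, heq⟩
    by_contra! hle
    have := unitSlopeFlux_strictMonoOn (κ := f v - dI h v) hf hh le_rfl hv.2
      (fun s hs => hmono ⟨hs.1.le, hs.2.le.trans hle⟩ ⟨hv.1.le, hle⟩ hs.2)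
      (left_mem_Icc.2 hv.1.le) (right_mem_Icc.2 hv.1.le) hv.1
    rw [unitSlopeFlux_zero hh, unitSlopeFlux] at this
    linarith
  have key : ∀ a ∈ tangencyPoints f h, ∀ b ∈ tangencyPoints f h, ¬ a < b := by
    rintro a ha b hb hab
    have hma := hbeyond a ha
    have hmb := hbeyond b hb
    obtain ⟨haI, ha⟩ := ha
    obtain ⟨hbI, hb⟩ := hb
    have hra : f b - dI h b < f a - dI h a := hanti ⟨hma.le, haI.2⟩ ⟨hmb.le, hbI.2⟩ hab
    have := unitSlopeFlux_strictAntiOn (κ := f b - dI h b) hf hh haI.1.le hbI.2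
      (fun s hs => hanti ⟨hma.le.trans hs.1.le, hs.2.le.trans hbI.2⟩ ⟨hmb.le, hbI.2⟩ hs.2)
      (left_mem_Icc.2 hab.le) (right_mem_Icc.2 hab.le) hab
    rw [unitSlopeFlux, unitSlopeFlux] at this
    nlinarith [haI.1]
  refine ⟨hbeyond, fun a ha b hb => ?_⟩
  exact le_antisymm (not_lt.1 (key b hb a ha)) (not_lt.1 (key a ha b hb))

end transition

/-! ### The three cases -/

section cases

variable {f h : ℝ → ℝ} {vp z : ℝ}

theorem IsTransition.limitFront_travelTime (hf : ReactionF f) (hh : ConvectionH h)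
    (ht : IsTransition f h vp) (hvp : vp ∈ Ioo (0 : ℝ) 1) :
    limitFront f h vp (travelTime (limitInvSlope f h vp) vp) = vp :=
  (ht.isTravelTime hf hh).heightAt_eq hvp rfl

/-- An interior transition at height `vp` occurs at the position `travelTime _ vp`; to the right of
it the limit front is the inviscid profile through any of its points. -/
theorem IsTransition.isInviscidProfile_Ici (hf : ReactionF f) (hh : ConvectionH h)
    (ht : IsTransition f h vp) (hvp : vp ∈ Ioo (0 : ℝ) 1)
    (hz : travelTime (limitInvSlope f h vp) vp ≤ z) :
    IsInviscidProfile f h (f vp - dI h vp) z (limitFront f h vp z)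
      (Ici (travelTime (limitInvSlope f h vp) vp)) (limitFront f h vp) := by
  rw [← S_eq_of_isMax hf hh hvp ht.S_le]
  have hge : ∀ z ∈ Ici (travelTime (limitInvSlope f h vp) vp), vp ≤ limitFront f h vp z :=
    fun z hz => (ht.limitFront_travelTime hf hh hvp).symm.trans_le (monotone_heightAt _ hz)
  exact ht.isInviscidProfile hf hh hvp.2 ordConnected_Ici (by rw [interior_Ici]; exact nonempty_Ioi)
    (fun z hz => hvp.1.trans_le (hge z hz)) hge hz

end cases

end BornInfeld

theorem theorem1 (f h : ℝ → ℝ) (hf : ReactionF f) (hh : ConvectionH h) :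
    -- the critical speed and the critical profile are well defined
    (∀ ε > 0, IsLeast {c | IsAdmissible f h ε c} (criticalSpeed f h ε) ∧
      IsFrontProfile f h ε (criticalSpeed f h ε) (criticalProfile f h ε) ∧
      ∀ v, IsFrontProfile f h ε (criticalSpeed f h ε) v → v = criticalProfile f h ε) ∧
    -- case 1
    ((∀ v ∈ Ioc (0 : ℝ) 1, dI (S f h) v < 0) →
      Tendsto (criticalSpeed f h) (𝓝[>] 0) (𝓝 0) ∧
      ∃ vbar : ℝ → ℝ,
        TendstoUniformly (criticalProfile f h) vbar (𝓝[>] 0) ∧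
        IsInviscidProfile f h 0 0 (1 / 2) {z | 0 < vbar z} vbar ∧
        ∀ z ∉ {z | 0 < vbar z}, vbar z = 0) ∧
    -- case 2
    (0 < supS f h → supS f h ≠ S f h 1 →
      ∃ vp : ℝ, IsGreatest {v | v ∈ tangencyPoints f h ∧ S f h v = supS f h} vp ∧
        Tendsto (criticalSpeed f h) (𝓝[>] 0) (𝓝 (f vp - dI h vp)) ∧
        (HasUniqueMaximumPoint (fun v => f v - dI h v) →
          IsGreatest (tangencyPoints f h) vp ∧
          ∃ vbar : ℝ → ℝ,
            TendstoUniformly (criticalProfile f h) vbar (𝓝[>] 0) ∧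
            ContDiffOn ℝ 1 vbar {z | 0 < vbar z} ∧
            (1 / 2 ≤ vp →
              ∃ V : ℝ → ℝ,
                IsInviscidProfile f h (f vp - dI h vp) (vp - 1 / 2) vp (Ici (vp - 1 / 2)) V ∧
                (∀ z ≤ vp - 1 / 2, vbar z = linearProfile 0 (1 / 2) z) ∧
                (∀ z > vp - 1 / 2, vbar z = V z)) ∧
            (vp < 1 / 2 →
              ∃ zp < 0, ∃ V : ℝ → ℝ,
                IsInviscidProfile f h (f vp - dI h vp) 0 (1 / 2) (Ici zp) V ∧
                V zp = vp ∧
                (∀ (J : Set ℝ) (W : ℝ → ℝ),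
                  IsInviscidSolution f h (f vp - dI h vp) 0 (1 / 2) J W →
                    ∀ z ∈ J, W z = vp → z = zp) ∧
                (∀ z ≤ zp, vbar z = linearProfile zp vp z) ∧
                (∀ z > zp, vbar z = V z)))) ∧
    -- case 3
    ((∀ v ∈ Ioo (0 : ℝ) 1, 0 < dI (S f h) v) →
      Tendsto (criticalSpeed f h) (𝓝[>] 0) (𝓝 (primitiveF f 1 - h 1)) ∧
      TendstoUniformly (criticalProfile f h) (linearProfile 0 (1 / 2)) (𝓝[>] 0)) := by
  refine ⟨fun ε hε => ⟨isLeast_criticalSpeed hf hh hε, isFrontProfile_criticalProfile hf hh hε,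
    fun v hv => ?_⟩, fun hS => ?_, fun h0 h1 => ?_, fun hS => ?_⟩
  · exact (existsUnique_isFrontProfile hf hh hε (isLeast_criticalSpeed hf hh hε).1).unique hv
      (isFrontProfile_criticalProfile hf hh hε)
  -- `S` decreases: the transition is at height `0`
  · have ht := isTransition_zero hf hh hS
    have h0 : 0 < limitFront f h 0 0 := by rw [limitFront_zero hf hh ht]; norm_num
    refine ⟨by simpa only [S_zero] using tendsto_criticalSpeed hf hh ht.mem ht.S_le,
      limitFront f h 0, ht.tendstoUniformly hf hh, ?_, fun z hz => ?_⟩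
    · have hord : {z | 0 < limitFront f h 0 z}.OrdConnected :=
        ⟨fun x hx y _ z hz => lt_of_lt_of_le hx (monotone_heightAt _ hz.1)⟩
      have := ht.isInviscidProfile hf hh zero_lt_one hord
        (by rw [(ht.isOpen_limitFront_pos hf hh).interior_eq]; exact ⟨0, h0⟩)
        (fun z hz => hz) (fun z _ => heightAt_mem_Icc.1) (z₀ := 0) h0
      rwa [S_zero, limitFront_zero hf hh ht] at this
    · exact le_antisymm (not_lt.1 hz) heightAt_mem_Icc.1
  -- the transition is at the largest maximum point of `S`
  · obtain ⟨vp, hvp, hvpS, hmax, hgr⟩ := exists_isGreatest_argmax hf hh h0 h1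
    have htan := mem_tangencyPoints_of_isMax hf hh hvp hmax
    refine ⟨vp, ⟨⟨htan, hvpS⟩, fun v hv => hgr v (Ioc_subset_Icc_self hv.1.1) hv.2⟩, ?_, ?_⟩
    · rw [← S_eq_of_isMax hf hh hvp hmax]
      exact tendsto_criticalSpeed hf hh (Ioo_subset_Icc_self hvp) hmax
    intro huniq
    obtain ⟨m, -, hmono, hanti⟩ :=
      huniq.exists_strictMonoOn (hf.continuousOn.sub hh.continuousOn_dI)
    obtain ⟨hbeyond, hsub⟩ := tangencyPoints_of_unimodal hf hh hmono hanti
    have hmv := hbeyond vp htan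
    have ht : IsTransition f h vp := by
      refine ⟨Ioo_subset_Icc_self hvp, hmax, fun v hv => ?_⟩
      rw [S_eq_of_isMax hf hh hvp hmax]
      exact hanti ⟨hmv.le, hvp.2.le⟩ ⟨hmv.le.trans hv.1.le, hv.2⟩ hv.1
    have hT := ht.isTravelTime hf hh
    have hhalf : (1 / 2 : ℝ) ∈ Ioo (0 : ℝ) 1 := by norm_num
    refine ⟨⟨htan, fun v hv => (hsub hv htan).le⟩, limitFront f h vp, ht.tendstoUniformly hf hh,
      ht.contDiffOn_limitFront hf hh hvp.2, fun hle => ?_, fun hlt => ?_⟩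
    · have hTvp : travelTime (limitInvSlope f h vp) vp = vp - 1 / 2 := by
        have := travelTime_limitInvSlope hf hh ht hhalf hvp hle le_rfl
        rwa [travelTime_half, sub_zero] at this
      refine ⟨limitFront f h vp, ?_, fun z hz => ?_, fun z _ => rfl⟩
      · have := ht.isInviscidProfile_Ici hf hh hvp le_rfl
        rwa [ht.limitFront_travelTime hf hh hvp, hTvp] at this
      · rw [ht.limitFront_eq_linearProfile hf hh hvp (hz.trans_eq hTvp.symm), hTvp]
        unfold linearProfile
        ring_nf
    · have hzp : travelTime (limitInvSlope f h vp) vp < 0 := by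
        have := hT.strictMonoOn hvp hhalf hlt
        rwa [travelTime_half] at this
      have hprof := ht.isInviscidProfile_Ici hf hh hvp hzp.le
      rw [limitFront_zero hf hh ht] at hprof
      have hvpT := ht.limitFront_travelTime hf hh hvp
      refine ⟨_, hzp, limitFront f h vp, hprof, hvpT, fun J W hW z hz hWz => ?_, fun z hz =>
        ht.limitFront_eq_linearProfile hf hh hvp hz, fun z _ => rfl⟩
      have heq := hprof.2 J W hW
      rcases le_or_gt (travelTime (limitInvSlope f h vp) vp) z with hle | hgt
      · have hz' : limitFront f h vp z = vp := (heq ⟨hle, hz⟩).symm.trans hWz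
        have hmem : limitFront f h vp z ∈ Ioo (0 : ℝ) 1 := by rw [hz']; exact hvp
        have := hT.apply_heightAt hmem
        change travelTime (limitInvSlope f h vp) (limitFront f h vp z) = z at this
        rw [hz'] at this
        exact this.symm
      -- a point of height `vp` to the left of the transition would be a second crossing
      · have hzpJ := hW.ordConnected.out hz hW.mem ⟨hgt.le, hzp.le⟩
        refine hW.eq_of_apply_eq (hf.pos vp hvp) (sub_add_cancel _ _) hz hzpJ hWz ?_
        exact (heq ⟨self_mem_Ici, hzpJ⟩).trans hvpT
  -- `S` increases: the transition is at height `1`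
  · have ht := isTransition_one hf hh hS
    constructor
    · have := tendsto_criticalSpeed hf hh ht.mem ht.S_le
      rwa [show S f h 1 = primitiveF f 1 - h 1 by simp [S]] at this
    · have := ht.tendstoUniformly hf hh
      rw [← ht.limitFront_one hf hh]
      exact this
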